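/- **Theorem (Weak Search).** Circuits are composed of elementary gates, i.e. arbitrary unitaries acting on at most two qubits, and the size of a circuit is its number of gates. A circuit acts on an index register of $n$ qubits, one flag qubit and some ancillary qubits; its basis states are written $|j,b,z\rangle$ with $0\le j<N=2^n$ in binary, $b\in\{0,1\}$ and $z$ a bit string. There are constants $C>0$ and $k\in\mathbb{N}$ such that for all integers $n\ge 1$ and $x\ge 0$, with $N=2^n$, there are $y\ge 0$ and a quantum circuit $\mathcal{B}$ with $y$ ancillary qubits and with oracle access to a circuit with $x$ ancillary qubits (it may call the oracle and the inverse of the oracle on any of its qubits; $\mathcal B$ depends only on $n$ and $x$) with the following properties. Write $\mathcal{B}[\mathcal{D}]$ for the circuit obtained by using the circuit $\mathcal D$ as the oracle. 1. $\mathcal{B}$ makes at most $C\sqrt{N}\,(\log_2 N)^k=\tilde O(\sqrt N)$ oracle calls (calls to the inverse included). 2. For every circuit $\mathcal{D}$ on $n+1+x$ qubits each of whose $x$ ancillary qubits is acted on by at least one gate, $\operatorname{size}(\mathcal{B}[\mathcal{D}])\le C\sqrt{N}\,(\log_2 N)^k\cdot\max(1,\operatorname{size}(\mathcal{D}))$.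 3. Let $F:\{0,\dots,N-1\}\to\{0,1,2\}$ be any function and let $\mathcal{D}$ be any circuit on $n+1+x$ qubits such that, for every $j$ with $F(j)\in\{0,1\}$, $$|\langle j,F(j),0^x|\,\mathcal{D}\,|j,0,0^x\rangle|^2\ \ge\ \tfrac23$$ (nothing is assumed about $j$ with $F(j)=2$). If $F^{-1}(1)\neq\varnothing$, then $$\sum_{j\in F^{-1}(\{1,2\})}|\langle j,1,0^y|\,\mathcal{B}[\mathcal{D}]\,|0,0,0^y\rangle|^2\ \ge\ \tfrac23 .$$ In every case, the probability that measuring $\mathcal{B}[\mathcal{D}]\,|0,0,0^y\rangle$ yields flag $1$ and an index $j$ with $F(j)=0$ is at most $\tfrac13$: $$\sum_{j\in F^{-1}(0)}\ \sum_{z\in\{0,1\}^y}|\langle j,1,z|\,\mathcal{B}[\mathcal{D}]\,|0,0,0^y\rangle|^2\ \le\ \tfrac13 .$$ -/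

import Mathlib

noncomputable section

namespace QCirc

/-- The operator on the qubits `W` that applies `M` to the qubits `e v`, `v : V`, and the identity
to all the others. Computational basis states of the qubits `W` are the functions `W → Bool`; rows
are outputs and columns are inputs. -/
def opOn {V W : Type} (e : V ↪ W) (M : Matrix (V → Bool) (V → Bool) ℂ) :
    Matrix (W → Bool) (W → Bool) ℂ :=
  open Classical in
  fun s t => if ∀ w, w ∉ Set.range e → s w = t w then M (s ∘ e) (t ∘ e) else 0

/-- An elementary gate: an arbitrary unitary acting on at most two distinct qubits. -/
structure Gate (W : Type) where
  arity : ℕ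
  arity_le : arity ≤ 2
  wires : Fin arity ↪ W
  op : Matrix.unitaryGroup (Fin arity → Bool) ℂ

/-- The unitary operator of a gate. -/
def Gate.eval {W : Type} (g : Gate W) : Matrix (W → Bool) (W → Bool) ℂ :=
  opOn g.wires (g.op : Matrix (Fin g.arity → Bool) (Fin g.arity → Bool) ℂ)

/-- The inverse gate. -/
def Gate.inv {W : Type} (g : Gate W) : Gate W :=
  { g with op := g.op⁻¹ }

/-- The same gate, applied to the qubits renamed by `e`. -/
def Gate.relabel {V W : Type} (e : V ↪ W) (g : Gate V) : Gate W where
  arity := g.arity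
  arity_le := g.arity_le
  wires := g.wires.trans e
  op := g.op

/-- A quantum circuit on the qubits `W`: a list of gates, the first one being applied first. -/
abbrev Circuit (W : Type) := List (Gate W)

namespace Circuit

/-- The unitary operator of a circuit. -/
def eval {W : Type} [Fintype W] [DecidableEq W] :
    Circuit W → Matrix (W → Bool) (W → Bool) ℂ
  | [] => 1
  | g :: c => eval c * g.eval

/-- The size of a circuit: its number of gates. -/
def size {W : Type} (c : Circuit W) : ℕ := c.length

/-- The inverse circuit: the inverse gates in reverse order. -/
def inv {W : Type} (c : Circuit W) : Circuit W := (c.map Gate.inv).reverse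

/-- The same circuit, run on the qubits renamed by `e`. -/
def relabel {V W : Type} (e : V ↪ W) (c : Circuit V) : Circuit W := c.map (Gate.relabel e)

/-- Some gate of the circuit acts on the qubit `w`. -/
def Uses {W : Type} (c : Circuit W) (w : W) : Prop := ∃ g ∈ c, w ∈ Set.range g.wires

end Circuit

/-- An instruction of a circuit on the qubits `W` with oracle access to a circuit on the qubits
`V`: an elementary gate, or a call to the oracle or to its inverse on chosen distinct qubits. -/
inductive Instr (V W : Type) where
  | gate (g : Gate W)
  | query (e : V ↪ W)
  | queryInv (e : V ↪ W)

/-- A quantum circuit on the qubits `W` with oracle access to a circuit on the qubits `V`. -/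
abbrev OracleCircuit (V W : Type) := List (Instr V W)

/-- The circuit that an instruction stands for when the oracle is the circuit `D`. -/
def Instr.expand {V W : Type} (D : Circuit V) : Instr V W → Circuit W
  | .gate g => [g]
  | .query e => D.relabel e
  | .queryInv e => D.inv.relabel e

/-- The number of oracle calls (to the oracle or to its inverse) of an instruction. -/
def Instr.cost {V W : Type} : Instr V W → ℕ
  | .gate _ => 0
  | .query _ => 1
  | .queryInv _ => 1

namespace OracleCircuit

/-- The circuit obtained by using the circuit `D` as the oracle. -/
def run {V W : Type} (B : OracleCircuit V W) (D : Circuit V) : Circuit W :=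
  B.flatMap (Instr.expand D)

/-- The number of oracle calls (to the oracle or to its inverse). -/
def queries {V W : Type} (B : OracleCircuit V W) : ℕ := (B.map Instr.cost).sum

end OracleCircuit

/-- An index register of `n` qubits, a flag qubit, and `a` ancillary qubits. -/
abbrev Wire (n a : ℕ) := Fin n ⊕ Unit ⊕ Fin a

/-- The basis state `|j, b, z⟩`, the number `j` being written in binary in the index register. -/
def ket {n a : ℕ} (j : Fin (2 ^ n)) (b : Bool) (z : Fin a → Bool) : Wire n a → Bool :=
  Sum.elim (fun i => (j : ℕ).testBit i) (Sum.elim (fun _ => b) z)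

/-- The basis state `0 ⋯ 0` of a register. -/
def zeros {a : ℕ} : Fin a → Bool := fun _ => false

/-- The amplitude `⟨j', b', z'| c |j, b, z⟩`, in the order output, then input. -/
def amp {n a : ℕ} (c : Circuit (Wire n a))
    (j' : Fin (2 ^ n)) (b' : Bool) (z' : Fin a → Bool)
    (j : Fin (2 ^ n)) (b : Bool) (z : Fin a → Bool) : ℂ :=
  c.eval (ket j' b' z') (ket j b z)

end QCirc

end

noncomputable section

namespace QCirc

open Matrix

variable {V W : Type}

/-! ### Operators on a set of qubits -/

/-! Write N = 2^n. The search is amplitude amplification driven by an imperfect oracle, arranged so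
that neither the number of solutions nor the behaviour of the oracle at indices with `F j = 2` has
to be known.

One primitive does the work: `ampStep` replaces T by T R₀ T⁻¹ R_h T, where both R's apply the same
phase α with (1 - α)² = -αc. On a fixed initial state it multiplies the probability q of missing the
target value by (1 - c(1 - q))² (`prob_ampStep`), and it rescales all amplitudes on the target by
one common scalar of modulus at most 3 (`ampStep_eq_mul`).

Gap: the oracle runs on a copy of the index, so different indices do not interact. With c = 1 a step
cubes the miss probability. Alternating the target value pushes flag probabilities at most 1/3 below
4^-(n+2) and keeps those at least 2/3 above 22/25 (`prob_gap_small`, `prob_gap_large`), at the cost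
of O(n²) oracle calls.

Flag: computing, recording and uncomputing the flag turns the amplified probability P_j into an
amplitude: the basis state with index j, flag 1 and all else 0 gets exactly P_j/√N, and no other
flagged state occurs (`exists_flag`).

Search: with c taken from the Chebyshev polynomial T₃, the bound cosh(u)² q ≤ 1 becomes cosh(3^m u)²
q ≤ 1 after m steps (`chebList_prob`). Taking 3^m of order √N and u = 3/3^m leaves a miss
probability of at most 1/16 if a solution exists. In every case the flagged amplitudes have grown by
a common factor of modulus at most 3^m (`chebList_eq_mul`), so the indices with `F j = 0` carry
total probability at most 1/7. The indices with value 1 or 2 then carry at least 15/16 - 1/7 ≥ 2/3.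

Cost: each step triples the circuit and adds a multiply controlled phase with O(n + x) gates. Each
gate of the oracle touches at most two qubits, so using all its ancillas forces x ≤ 2 size(D). -/

theorem opOn_apply (e : V ↪ W) (M : Matrix (V → Bool) (V → Bool) ℂ) (s t : W → Bool)
    [Decidable (∀ w, w ∉ Set.range e → s w = t w)] :
    opOn e M s t = if ∀ w, w ∉ Set.range e → s w = t w then M (s ∘ e) (t ∘ e) else 0 := by
  unfold opOn
  congr

theorem extend_eq_self_of_agree (e : V ↪ W) {s t : W → Bool}
    (h : ∀ w, w ∉ Set.range e → s w = t w) : Function.extend e (t ∘ e) s = t := by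
  funext w
  by_cases hw : w ∈ Set.range e
  · obtain ⟨v, rfl⟩ := hw
    simp [e.injective.extend_apply]
  · rw [Function.extend_apply' _ _ _ (by simpa using hw), h w hw]

theorem extend_comp_self (e : V ↪ W) (a : V → Bool) (s : W → Bool) :
    Function.extend e a s ∘ e = a := by
  funext v
  simp [e.injective.extend_apply]

theorem extend_off (e : V ↪ W) (a : V → Bool) (s : W → Bool) {w : W} (hw : w ∉ Set.range e) :
    Function.extend e a s w = s w :=
  Function.extend_apply' _ _ _ (by simpa using hw)

theorem extend_extend (e : V ↪ W) (a b : V → Bool) (s : W → Bool) :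
    Function.extend e b (Function.extend e a s) = Function.extend e b s := by
  funext w
  by_cases hw : w ∈ Set.range e
  · obtain ⟨v, rfl⟩ := hw
    simp [e.injective.extend_apply]
  · simp [extend_off e _ _ hw]

section

variable [Fintype V] [DecidableEq V] [Fintype W] [DecidableEq W]

/-- In row `s` only the columns agreeing with `s` off the range of `e` survive, and they are
parametrized by the values put on that range. -/
theorem opOn_mul_apply {κ : Type} (e : V ↪ W) (M : Matrix (V → Bool) (V → Bool) ℂ)
    (X : Matrix (W → Bool) κ ℂ) (s : W → Bool) (r : κ) :
    (opOn e M * X) s r = ∑ a, M (s ∘ e) a * X (Function.extend e a s) r := by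
  classical
  rw [Matrix.mul_apply]
  symm
  refine Finset.sum_of_injOn (fun a => Function.extend e a s) ?_ ?_ ?_ ?_
  · intro a _ b _ hab
    have := congrArg (· ∘ e) hab
    simpa [extend_comp_self] using this
  · intro a _
    simp
  · intro t _ ht
    rw [opOn_apply, if_neg, zero_mul]
    intro h
    exact ht ⟨t ∘ e, by simp, extend_eq_self_of_agree e h⟩
  · intro a _
    rw [opOn_apply, if_pos, extend_comp_self]
    intro w hw
    rw [extend_off e _ _ hw]

theorem opOn_one (e : V ↪ W) : opOn e 1 = 1 := by
  classical
  ext s t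
  rw [opOn_apply]
  by_cases h : s = t
  · subst h
    rw [if_pos fun _ _ => rfl, Matrix.one_apply_eq, Matrix.one_apply_eq]
  · rw [Matrix.one_apply_ne h]
    split_ifs with h'
    · refine Matrix.one_apply_ne fun h2 => h ?_
      rw [← extend_eq_self_of_agree e h', ← h2]
      exact (extend_eq_self_of_agree e (fun _ _ => rfl)).symm
    · rfl

theorem opOn_mul (e : V ↪ W) (M N : Matrix (V → Bool) (V → Bool) ℂ) :
    opOn e M * opOn e N = opOn e (M * N) := by
  ext s t
  have key : ∀ (X : Matrix (W → Bool) (W → Bool) ℂ),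
      (opOn e M * (opOn e N * X)) s t = (opOn e (M * N) * X) s t := by
    intro X
    have h (a : V → Bool) : (opOn e N * X) (Function.extend e a s) t
        = ∑ b, N a b * X (Function.extend e b s) t := by
      rw [opOn_mul_apply, extend_comp_self]
      simp only [extend_extend]
    rw [opOn_mul_apply, opOn_mul_apply]
    simp only [h, Matrix.mul_apply, Finset.mul_sum, Finset.sum_mul]
    rw [Finset.sum_comm]
    simp only [mul_assoc]
  simpa using key 1

theorem opOn_star (e : V ↪ W) (M : Matrix (V → Bool) (V → Bool) ℂ) :
    star (opOn e M) = opOn e (star M) := by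
  classical
  ext s t
  rw [Matrix.star_apply, opOn_apply, opOn_apply]
  by_cases h : ∀ w, w ∉ Set.range e → s w = t w
  · rw [if_pos h, if_pos fun w hw => (h w hw).symm, Matrix.star_apply]
  · rw [if_neg h, if_neg fun h' => h fun w hw => (h' w hw).symm, star_zero]

theorem opOn_trans {U : Type} [Fintype U] [DecidableEq U] (f : U ↪ V) (e : V ↪ W)
    (M : Matrix (U → Bool) (U → Bool) ℂ) : opOn (f.trans e) M = opOn e (opOn f M) := by
  classical
  ext s t
  rw [opOn_apply, opOn_apply, opOn_apply]
  by_cases h : ∀ w, w ∉ Set.range (f.trans e) → s w = t w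
  · rw [if_pos h, if_pos, if_pos]
    · rfl
    · intro v hv
      refine h _ ?_
      rintro ⟨u, hu⟩
      exact hv ⟨u, e.injective hu⟩
    · intro w hw
      refine h _ ?_
      rintro ⟨u, hu⟩
      exact hw ⟨f u, hu⟩
  · rw [if_neg h]
    split_ifs with h1 h2
    · refine absurd (fun w hw => ?_) h
      by_cases hw' : w ∈ Set.range e
      · obtain ⟨v, rfl⟩ := hw'
        refine h2 v ?_
        rintro ⟨u, rfl⟩
        exact hw ⟨u, rfl⟩
      · exact h1 w hw'
    · rfl
    · rfl

theorem opOn_equiv (e : V ≃ W) (M : Matrix (V → Bool) (V → Bool) ℂ) (s t : W → Bool) :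
    opOn e.toEmbedding M s t = M (s ∘ e) (t ∘ e) := by
  classical
  rw [opOn_apply, if_pos]
  · rfl
  · intro w hw
    exact absurd ⟨e.symm w, by simp⟩ hw

/-- The operator on the qubits `W` that applies the unitary `M` to the qubits `e v`. -/
def opOnU (e : V ↪ W) (M : unitaryGroup (V → Bool) ℂ) : unitaryGroup (W → Bool) ℂ :=
  ⟨opOn e M, by
    rw [Matrix.mem_unitaryGroup_iff', opOn_star, opOn_mul, Matrix.UnitaryGroup.star_mul_self,
      opOn_one]⟩

end

/-! ### Evaluation of circuits -/

theorem Gate.inv_inv (g : Gate W) : g.inv.inv = g := by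
  cases g
  simp only [Gate.inv]
  congr 1
  exact _root_.inv_inv _

namespace Circuit

theorem inv_inv (c : Circuit W) : c.inv.inv = c := by
  simp [Circuit.inv, List.map_reverse, Function.comp_def, Gate.inv_inv]

theorem inv_append (c d : Circuit W) : Circuit.inv (c ++ d) = d.inv ++ c.inv := by
  simp [Circuit.inv]

theorem inv_relabel (e : V ↪ W) (c : Circuit V) : (c.relabel e).inv = c.inv.relabel e := by
  simp [Circuit.inv, Circuit.relabel, Function.comp_def]
  intro g _
  rfl

variable [Fintype W] [DecidableEq W]

theorem eval_append (c d : Circuit W) : eval (c ++ d) = eval d * eval c := by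
  induction c with
  | nil => simp [eval]
  | cons g c ih => simp [eval, ih, mul_assoc]

theorem eval_singleton (g : Gate W) : eval [g] = g.eval := by
  simp [eval]

theorem eval_inv (c : Circuit W) : eval c.inv = star (eval c) := by
  induction c with
  | nil => simp [inv, eval]
  | cons g c ih =>
    have : inv (g :: c) = inv c ++ [g.inv] := by simp [inv]
    rw [this, eval_append, eval_singleton, ih, eval, StarMul.star_mul]
    congr 1
    simp [Gate.eval, opOn_star, Gate.inv]

theorem eval_mem (c : Circuit W) : eval c ∈ unitaryGroup (W → Bool) ℂ := by
  induction c with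
  | nil => simp [eval]
  | cons g c ih => exact mul_mem ih (opOnU g.wires g.op).2

/-- The unitary operator of a circuit, as an element of the unitary group. -/
def evalU (c : Circuit W) : unitaryGroup (W → Bool) ℂ := ⟨eval c, eval_mem c⟩

theorem eval_relabel [Fintype V] [DecidableEq V] (e : V ↪ W) (c : Circuit V) :
    eval (c.relabel e) = opOn e (eval c) := by
  induction c with
  | nil => simp [relabel, eval, opOn_one]
  | cons g c ih =>
    have : relabel e (g :: c) = g.relabel e :: relabel e c := rfl
    rw [this, eval, eval, ih, ← opOn_mul]
    congr 1
    exact opOn_trans _ _ _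

end Circuit

/-! ### Circuits with oracle access -/

namespace OracleCircuit

/-- The inverse of an instruction. -/
def _root_.QCirc.Instr.inv : Instr V W → Instr V W
  | .gate g => .gate g.inv
  | .query e => .queryInv e
  | .queryInv e => .query e

/-- The inverse of a circuit with oracle access. -/
def inv (B : OracleCircuit V W) : OracleCircuit V W := (B.map Instr.inv).reverse

theorem run_append (B C : OracleCircuit V W) (D : Circuit V) :
    run (B ++ C) D = run B D ++ run C D := by
  simp [run]

theorem run_inv (B : OracleCircuit V W) (D : Circuit V) :
    run (inv B) D = Circuit.inv (run B D) := by
  induction B with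
  | nil => rfl
  | cons i B ih =>
    have h1 : inv (i :: B) = inv B ++ [i.inv] := by simp [inv]
    have h2 : run (i :: B) D = i.expand D ++ run B D := by simp [run]
    rw [h1, h2, run_append, ih, Circuit.inv_append]
    congr 1
    cases i with
    | gate g => simp [run, Instr.inv, Instr.expand, Circuit.inv]
    | query e => simp [run, Instr.inv, Instr.expand, Circuit.inv_relabel]
    | queryInv e => simp [run, Instr.inv, Instr.expand, Circuit.inv_relabel, Circuit.inv_inv]

/-- The same circuit with oracle access, run on the qubits renamed by `e`. -/
def relabel {U : Type} (e : W ↪ U) (B : OracleCircuit V W) : OracleCircuit V U :=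
  B.map fun
    | .gate g => .gate (g.relabel e)
    | .query f => .query (f.trans e)
    | .queryInv f => .queryInv (f.trans e)

theorem run_relabel {U : Type} (e : W ↪ U) (B : OracleCircuit V W) (D : Circuit V) :
    run (relabel e B) D = Circuit.relabel e (run B D) := by
  induction B with
  | nil => rfl
  | cons i B ih =>
    have h2 : run (i :: B) D = i.expand D ++ run B D := by simp [run]
    have h3 : ∀ c d : Circuit W, Circuit.relabel e (c ++ d) = c.relabel e ++ d.relabel e := by
      simp [Circuit.relabel]
    have h4 : ∀ f : V ↪ W, ∀ c : Circuit V, c.relabel (f.trans e) = (c.relabel f).relabel e := by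
      intro f c
      simp only [Circuit.relabel, List.map_map]
      rfl
    rw [h2, h3, ← ih]
    cases i with
    | gate g => simp [relabel, run, Instr.expand, Circuit.relabel]
    | query f => simp [relabel, run, Instr.expand, h4]
    | queryInv f => simp [relabel, run, Instr.expand, h4]

/-- The cost of a circuit with oracle access when a gate costs `a` and an oracle call `b`. -/
def weight (a b : ℕ) (B : OracleCircuit V W) : ℕ :=
  (B.map fun
    | .gate _ => a
    | .query _ => b
    | .queryInv _ => b).sum

theorem weight_append (a b : ℕ) (B C : OracleCircuit V W) :
    weight a b (B ++ C) = weight a b B + weight a b C := by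
  simp [weight]

theorem weight_inv (a b : ℕ) (B : OracleCircuit V W) : weight a b B.inv = weight a b B := by
  simp only [weight, inv, List.map_reverse, List.sum_reverse, List.map_map]
  congr 2
  funext i
  cases i <;> rfl

theorem weight_relabel {U : Type} (a b : ℕ) (e : W ↪ U) (B : OracleCircuit V W) :
    weight a b (relabel e B) = weight a b B := by
  simp only [weight, relabel, List.map_map]
  congr 2
  funext i
  cases i <;> rfl

/-- Together with `size_run` this reduces both resource bounds to a single estimate of `weight a b`.
-/
theorem queries_eq_weight (B : OracleCircuit V W) : B.queries = weight 0 1 B := by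
  simp only [weight, queries]
  congr 2

theorem size_run (B : OracleCircuit V W) (D : Circuit V) :
    (B.run D).size = weight 1 D.size B := by
  simp only [Circuit.size, run, weight, List.length_flatMap]
  congr 2
  funext i
  cases i <;> simp [Instr.expand, Circuit.relabel, Circuit.inv]

/-- A list of gates as a circuit with oracle access that makes no oracle call. -/
def ofGates (c : Circuit W) : OracleCircuit V W := c.map .gate

theorem run_ofGates (c : Circuit W) (D : Circuit V) : run (ofGates c) D = c := by
  induction c with
  | nil => rfl
  | cons g c ih =>
    have : run (ofGates (g :: c)) D = g :: run (ofGates c) D := rfl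
    rw [this, ih]

theorem weight_ofGates (a b : ℕ) (c : Circuit W) :
    weight a b (ofGates c : OracleCircuit V W) = c.length * a := by
  induction c with
  | nil => simp [weight, ofGates]
  | cons g c ih =>
    have : weight a b (ofGates (g :: c) : OracleCircuit V W)
      = a + weight a b (ofGates c : OracleCircuit V W) := rfl
    rw [this, ih, List.length_cons]
    ring

end OracleCircuit

theorem card_uses_le (c : Circuit W) :
    {w | c.Uses w}.Finite ∧ {w | c.Uses w}.ncard ≤ 2 * c.size := by
  induction c with
  | nil => simp [Circuit.Uses]
  | cons g c ih =>
    have h : {w | Circuit.Uses (g :: c) w} = Set.range g.wires ∪ {w | Circuit.Uses c w} := by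
      ext w
      simp [Circuit.Uses]
    have h1 : (Set.range g.wires).ncard ≤ 2 := by
      rw [← Set.image_univ]
      refine (Set.ncard_image_le).trans ?_
      simpa [Set.ncard_univ] using g.arity_le
    rw [h]
    refine ⟨(Set.finite_range _).union ih.1, (Set.ncard_union_le _ _).trans ?_⟩
    have := ih.2
    simp only [Circuit.size, List.length_cons] at *
    omega

/-! ### Uniformly controlled one-qubit unitaries -/

section Uniform

variable {W : Type} [Fintype W] [DecidableEq W]

/-- The operator that applies to the qubit `t` the unitary `M s`, which depends on the values `s` of
the other qubits. -/
def uc (t : W) (M : (W → Bool) → unitaryGroup Bool ℂ) : Matrix (W → Bool) (W → Bool) ℂ :=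
  fun s s' => if ∀ w, w ≠ t → s w = s' w then
    -- Resetting the target makes the choice of `M` independent of its value, so `uc` is unitary for
    -- every `M`.
    (M (Function.update s t false) : Matrix Bool Bool ℂ) (s t) (s' t) else 0

theorem uc_apply (t : W) (M : (W → Bool) → unitaryGroup Bool ℂ) (s s' : W → Bool) :
    uc t M s s' = if ∀ w, w ≠ t → s w = s' w then
      (M (Function.update s t false) : Matrix Bool Bool ℂ) (s t) (s' t) else 0 := rfl

theorem update_eq_of_agree {t : W} {s s' : W → Bool} (h : ∀ w, w ≠ t → s w = s' w) (b : Bool) :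
    Function.update s t b = Function.update s' t b := by
  funext w
  by_cases hw : w = t
  · subst hw; simp
  · simp [hw, h w hw]

theorem uc_mul_apply {κ : Type} (t : W) (M : (W → Bool) → unitaryGroup Bool ℂ)
    (X : Matrix (W → Bool) κ ℂ) (s : W → Bool) (r : κ) :
    (uc t M * X) s r = ∑ b, (M (Function.update s t false) : Matrix Bool Bool ℂ) (s t) b *
      X (Function.update s t b) r := by
  rw [Matrix.mul_apply]
  symm
  refine Finset.sum_of_injOn (fun b => Function.update s t b) ?_ ?_ ?_ ?_
  · intro a _ b _ hab
    simpa using congrFun hab t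
  · intro a _
    simp
  · intro s' _ hs'
    rw [uc_apply, if_neg, zero_mul]
    intro h
    refine hs' ⟨s' t, by simp, ?_⟩
    simp [update_eq_of_agree h]
  · intro b _
    rw [uc_apply, if_pos]
    · simp
    · intro w hw
      simp [hw]

theorem uc_mulVec (t : W) (M : (W → Bool) → unitaryGroup Bool ℂ) (v : (W → Bool) → ℂ)
    (s : W → Bool) :
    (uc t M *ᵥ v) s = ∑ b, (M (Function.update s t false) : Matrix Bool Bool ℂ) (s t) b *
      v (Function.update s t b) :=
  uc_mul_apply t M (fun s (_ : Unit) => v s) s ()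

theorem uc_one (t : W) : uc t (fun _ => 1) = 1 := by
  ext s s'
  rw [uc_apply]
  by_cases h : s = s'
  · subst h
    simp
  · rw [Matrix.one_apply_ne h]
    split_ifs with h'
    · refine Matrix.one_apply_ne fun h2 => h ?_
      funext w
      by_cases hw : w = t
      · rw [hw, h2]
      · exact h' w hw
    · rfl

theorem uc_mul (t : W) (M N : (W → Bool) → unitaryGroup Bool ℂ) :
    uc t M * uc t N = uc t (fun s => M s * N s) := by
  ext s s'
  rw [uc_mul_apply, uc_apply]
  have h1 : ∀ b, (∀ w, w ≠ t → Function.update s t b w = s' w) ↔ ∀ w, w ≠ t → s w = s' w := by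
    intro b
    refine forall₂_congr fun w hw => ?_
    simp [hw]
  simp only [uc_apply, h1]
  split_ifs with h
  · simp [Matrix.mul_apply]
  · simp

theorem uc_star (t : W) (M : (W → Bool) → unitaryGroup Bool ℂ) :
    star (uc t M) = uc t (fun s => (M s)⁻¹) := by
  ext s s'
  rw [Matrix.star_apply, uc_apply, uc_apply]
  by_cases h : ∀ w, w ≠ t → s w = s' w
  · rw [if_pos h, if_pos fun w hw => (h w hw).symm, update_eq_of_agree h]
    rfl
  · rw [if_neg h, if_neg fun h' => h fun w hw => (h' w hw).symm, star_zero]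

/-- `uc` as an element of the unitary group. -/
def ucU (t : W) (M : (W → Bool) → unitaryGroup Bool ℂ) : unitaryGroup (W → Bool) ℂ :=
  ⟨uc t M, by
    rw [Matrix.mem_unitaryGroup_iff', uc_star, uc_mul]
    simpa using uc_one t⟩

end Uniform

/-! ### One- and two-qubit gates -/

section Gates

variable {W : Type}

/-- The gate that applies `M b` to the qubit `t` when the qubit `c` has the value `b` (and an empty
gate if `c = t`). -/
def cGate [DecidableEq W] (c t : W) (M : Bool → unitaryGroup Bool ℂ) : Gate W :=
  if h : c = t then ⟨0, by norm_num, ⟨Fin.elim0, fun i => i.elim0⟩, 1⟩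
  else
    { arity := 2
      arity_le := le_rfl
      wires := ⟨![c, t], by
        intro i j hij
        fin_cases i <;> fin_cases j <;> simp_all [eq_comm]⟩
      op := ucU 1 fun a => M (a 0) }

theorem cGate_eval [Fintype W] [DecidableEq W] {c t : W} (h : c ≠ t)
    (M : Bool → unitaryGroup Bool ℂ) : (cGate c t M).eval = uc t fun s => M (s c) := by
  classical
  rw [cGate, dif_neg h]
  ext s s'
  rw [Gate.eval, opOn_apply, uc_apply]
  simp only [ucU]
  rw [uc_apply]
  have e1 : (∀ w, w ∉ Set.range ![c, t] → s w = s' w) ∧ s c = s' c ↔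
      ∀ w, w ≠ t → s w = s' w := by
    constructor
    · rintro ⟨h1, h2⟩ w hw
      by_cases hc : w = c
      · rw [hc, h2]
      · refine h1 w ?_
        rintro ⟨i, hi⟩
        fin_cases i
        · exact hc hi.symm
        · exact hw hi.symm
    · intro h1
      refine ⟨fun w hw => h1 w ?_, h1 c h⟩
      rintro rfl
      exact hw ⟨1, rfl⟩
  have e2 : (∀ w : Fin 2, w ≠ 1 → (s ∘ ![c, t]) w = (s' ∘ ![c, t]) w) ↔ s c = s' c := by
    constructor
    · intro h1
      exact h1 0 (by simp)
    · intro h1 w hw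
      fin_cases w
      · exact h1
      · simp at hw
  by_cases h1 : ∀ w, w ∉ Set.range ![c, t] → s w = s' w
  · by_cases h2 : s c = s' c
    · rw [if_pos (e1.1 ⟨h1, h2⟩)]
      refine (if_pos h1).trans ((if_pos (e2.2 h2)).trans ?_)
      simp [h]
      rfl
    · rw [if_neg fun h3 => h2 (e1.2 h3).2]
      exact (if_pos h1).trans (if_neg fun h3 => h2 (e2.1 h3))
  · rw [if_neg fun h3 => h1 (e1.2 h3).1]
    exact if_neg h1

/-- The diagonal one-qubit unitary that multiplies the basis state `b` by `α`. -/
def ph (b : Bool) (α : Circle) : unitaryGroup Bool ℂ :=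
  ⟨Matrix.diagonal fun i => if i = b then (α : ℂ) else 1, by
    rw [Matrix.mem_unitaryGroup_iff', Matrix.star_eq_conjTranspose, Matrix.diagonal_conjTranspose,
      Matrix.diagonal_mul_diagonal, Matrix.diagonal_eq_one]
    funext i
    by_cases h : i = b
    · simp [h, ← Complex.normSq_eq_conj_mul_self]
    · simp [h]⟩

theorem ph_apply (b : Bool) (α : Circle) (i j : Bool) :
    (ph b α : Matrix Bool Bool ℂ) i j = if i = j then (if i = b then (α : ℂ) else 1) else 0 := by
  simp [ph, Matrix.diagonal_apply]

/-- The rotation that maps the basis state `0` to the uniform superposition. -/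
def rot : unitaryGroup Bool ℂ :=
  ⟨Matrix.of fun i j => if !i && j then -(((√2)⁻¹ : ℝ) : ℂ) else (((√2)⁻¹ : ℝ) : ℂ), by
    have h : (((√2)⁻¹ : ℝ) : ℂ) * (((√2)⁻¹ : ℝ) : ℂ) = 1 / 2 := by
      rw [← Complex.ofReal_mul, ← mul_inv, Real.mul_self_sqrt (by norm_num)]
      norm_num
    have h' : star (((√2)⁻¹ : ℝ) : ℂ) = (((√2)⁻¹ : ℝ) : ℂ) := Complex.conj_ofReal _
    rw [Matrix.mem_unitaryGroup_iff']
    generalize (((√2)⁻¹ : ℝ) : ℂ) = c at h h'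
    ext i j
    rw [Matrix.mul_apply]
    simp only [Matrix.star_apply, Fintype.sum_bool]
    cases i <;> cases j <;> simp [h', h] <;> norm_num⟩

theorem rot_apply (i j : Bool) : (rot : Matrix Bool Bool ℂ) i j =
    if !i && j then -(((√2)⁻¹ : ℝ) : ℂ) else (((√2)⁻¹ : ℝ) : ℂ) := rfl

/-- The square of `rot`: a bit flip up to a sign. -/
def flip : unitaryGroup Bool ℂ := rot * rot

theorem flip_apply (i j : Bool) :
    (flip : Matrix Bool Bool ℂ) i j = if i = j then 0 else if j then -1 else 1 := by
  have h : (((√2)⁻¹ : ℝ) : ℂ) * (((√2)⁻¹ : ℝ) : ℂ) = 1 / 2 := by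
    rw [← Complex.ofReal_mul, ← mul_inv, Real.mul_self_sqrt (by norm_num)]
    norm_num
  change ((rot : Matrix Bool Bool ℂ) * (rot : Matrix Bool Bool ℂ)) i j = _
  rw [Matrix.mul_apply]
  simp only [rot_apply, Fintype.sum_bool]
  generalize (((√2)⁻¹ : ℝ) : ℂ) = c at h
  cases i <;> cases j <;> simp [h] <;> norm_num

theorem ph_mul_self : ph true (-1) * ph true (-1) = 1 := by
  apply Subtype.ext
  change (ph true (-1) : Matrix Bool Bool ℂ) * (ph true (-1) : Matrix Bool Bool ℂ) = 1
  ext i j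
  rw [Matrix.mul_apply]
  simp only [ph_apply, Fintype.sum_bool]
  cases i <;> cases j <;> simp

theorem ph_mul_rot : ph true (-1) * rot * ph true (-1) = rot⁻¹ := by
  apply Subtype.ext
  change (ph true (-1) : Matrix Bool Bool ℂ) * (rot : Matrix Bool Bool ℂ) *
    (ph true (-1) : Matrix Bool Bool ℂ) = star (rot : Matrix Bool Bool ℂ)
  have h' : star (((√2)⁻¹ : ℝ) : ℂ) = (((√2)⁻¹ : ℝ) : ℂ) := Complex.conj_ofReal _
  ext i j
  rw [Matrix.mul_apply]
  simp only [Matrix.mul_apply, Fintype.sum_bool, Matrix.star_apply, rot_apply, ph_apply]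
  generalize (((√2)⁻¹ : ℝ) : ℂ) = c at h'
  cases i <;> cases j <;> simp [h']

/-- Conjugating the rotation by the diagonal sign matrix inverts it, so the commutator of the two is
the square of the rotation. -/
theorem rot_ph_commutator : rot * (ph true (-1) * (rot⁻¹ * ph true (-1))) = flip := by
  rw [← ph_mul_rot, flip]
  have h := ph_mul_self
  calc rot * (ph true (-1) * (ph true (-1) * rot * ph true (-1) * ph true (-1)))
      = rot * ((ph true (-1) * ph true (-1)) * rot * (ph true (-1) * ph true (-1))) := by group
    _ = rot * rot := by rw [h]; group

/-- Flips the qubit `a`, up to a sign, if `c` has the value `1` and `w` the value `0`. -/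
def andG [DecidableEq W] (c w a : W) : Circuit W :=
  [cGate c a fun b => if b then ph true (-1) else 1,
    cGate w a fun b => if b then 1 else rot⁻¹,
    cGate c a fun b => if b then ph true (-1) else 1,
    cGate w a fun b => if b then 1 else rot]

/-- If at most one of the two conditions holds, the gates cancel in pairs; if both hold, they form
the commutator of `rot_ph_commutator`. -/
theorem andG_eval [Fintype W] [DecidableEq W] {c w a : W} (hc : c ≠ a) (hw : w ≠ a) :
    (andG c w a).eval = uc a fun s => if s c && !s w then flip else 1 := by
  simp only [andG, Circuit.eval, one_mul, cGate_eval hc, cGate_eval hw, uc_mul]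
  congr 1
  funext s
  cases s c <;> cases s w <;> simp [ph_mul_self, ← rot_ph_commutator, mul_assoc]

end Gates

/-! ### Multiply controlled one-qubit unitaries -/

section Flag

variable {W : Type} [Fintype W] [DecidableEq W]

/-- The sign in `flip` affects only the input value 1, so on a clean target the bit is written
without any sign. -/
theorem uc_flip_mulVec (a : W) (κ : (W → Bool) → Bool)
    (hκ : ∀ s b, κ (Function.update s a b) = κ s) (v : (W → Bool) → ℂ)
    (hv : ∀ s, v s ≠ 0 → s a = false) (s : W → Bool) :
    (uc a (fun s => if κ s then flip else 1) *ᵥ v) s =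
      if s a = κ s then v (Function.update s a false) else 0 := by
  have h0 : v (Function.update s a true) = 0 := by
    by_contra h
    simpa using hv _ h
  rw [uc_mulVec, Fintype.sum_bool, h0, hκ]
  cases hs : s a <;> cases κ s <;> simp [flip_apply]

theorem star_uc_flip_mulVec (a : W) (κ : (W → Bool) → Bool)
    (hκ : ∀ s b, κ (Function.update s a b) = κ s) (v : (W → Bool) → ℂ)
    (hv : ∀ s, v s ≠ 0 → s a = κ s) (s : W → Bool) :
    (star (uc a (fun s => if κ s then flip else 1)) *ᵥ v) s =
      if s a = false then v (Function.update s a (κ s)) else 0 := by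
  have h0 : ∀ b, b ≠ κ s → v (Function.update s a b) = 0 := by
    intro b hb
    by_contra h
    have := hv _ h
    rw [hκ] at this
    simp [hb] at this
  have hinv : ∀ i j, ((flip⁻¹ : unitaryGroup Bool ℂ) : Matrix Bool Bool ℂ) i j
      = if i = j then 0 else if i then -1 else 1 := by
    intro i j
    change star (flip : Matrix Bool Bool ℂ) i j = _
    rw [Matrix.star_apply, flip_apply]
    cases i <;> cases j <;> simp
  rw [uc_star, uc_mulVec, Fintype.sum_bool, hκ]
  cases hk : κ s
  · rw [h0 true (by simp [hk])]
    cases hs : s a <;> simp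
  · rw [h0 false (by simp [hk])]
    cases hs : s a <;> simp [hinv]

/-- Compute a condition into `a`, use it as a control, uncompute it. `hX` is asked only for the
vector that arises, because in the induction on the ladder the behaviour of the inner circuit is
known only on vectors with clean ladder qubits. -/
theorem conj_uc_flip_mulVec {a t : W} (hat : t ≠ a) (κ : (W → Bool) → Bool)
    (hκ : ∀ s b, κ (Function.update s a b) = κ s)
    (hκt : ∀ s b, κ (Function.update s t b) = κ s)
    (P : (W → Bool) → Prop) [DecidablePred P] (hP : ∀ s b, P (Function.update s a b) ↔ P s)
    (M : Matrix Bool Bool ℂ) (v : (W → Bool) → ℂ) (hv : ∀ s, v s ≠ 0 → s a = false)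
    (X : Matrix (W → Bool) (W → Bool) ℂ)
    (hX : ∀ v₁ : (W → Bool) → ℂ,
      v₁ = uc a (fun s => if κ s then flip else 1) *ᵥ v → ∀ s, (X *ᵥ v₁) s =
        if s a = true ∧ P s then ∑ b, M (s t) b * v₁ (Function.update s t b) else v₁ s)
    (s : W → Bool) :
    (star (uc a (fun s => if κ s then flip else 1)) *ᵥ
      (X *ᵥ (uc a (fun s => if κ s then flip else 1) *ᵥ v))) s =
      if κ s = true ∧ P s then ∑ b, M (s t) b * v (Function.update s t b) else v s := by
  have hv1 := uc_flip_mulVec a κ hκ v hv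
  have hX' := hX _ rfl
  generalize uc a (fun s => if κ s then flip else 1) *ᵥ v = v₁ at hv1 hX' ⊢
  -- Since `κ` does not depend on `t`, the operator `X` keeps `a` equal to `κ`; this makes the
  -- uncomputation clean.
  have hv2 : ∀ s, (X *ᵥ v₁) s ≠ 0 → s a = κ s := by
    intro s
    contrapose!
    intro h
    rw [hX']
    have h1 : ∀ b, v₁ (Function.update s t b) = 0 := by
      intro b
      rw [hv1, if_neg]
      rwa [hκt, Function.update_of_ne hat.symm]
    simp [h1, hv1, h]
  rw [star_uc_flip_mulVec a κ hκ _ hv2, hX']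
  simp only [hP, hv1, hκ, hκt, Function.update_self, Function.update_of_ne hat.symm,
    Function.update_of_ne hat, Function.update_idem, Function.update_comm hat]
  have h0 : ∀ s, s a = true → v s = 0 := by
    intro s hs
    by_contra h
    simp [hv s h] at hs
  cases hs : s a
  · have : ∀ s : W → Bool, s a = false → Function.update s a false = s := by
      intro s hs
      rw [← hs, Function.update_eq_self]
    simp [this s hs]
  · have : ∀ b, v (Function.update s t b) = 0 := fun b =>
      h0 _ (by rw [Function.update_of_ne hat.symm, hs])
    simp [this, h0 s hs]

end Flag

/-! ### A ladder of ancillary qubits for multiply controlled gates -/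

section Ladder

variable {β : Type} [DecidableEq β]

/-- Applies `M` to `t` if the qubit `c` of the ladder has the value `1` and the qubits in the list
have the value `0`. -/
def mcInner (t : β) (M : unitaryGroup Bool ℂ) : List β → Option β → Circuit (β ⊕ Option β)
  | [], c => [cGate (.inr c) (.inl t) fun b => if b then M else 1]
  | w :: l, c => andG (.inr c) (.inl w) (.inr (some w)) ++ mcInner t M l (some w) ++
      Circuit.inv (andG (.inr c) (.inl w) (.inr (some w)))

/-- Applies `M` to `t` if the qubits in the list `S` have the value `0`. The right summand of the
set of qubits is a ladder of ancillary qubits. -/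
def mc (S : List β) (t : β) (M : unitaryGroup Bool ℂ) : Circuit (β ⊕ Option β) :=
  -- The control is a dummy: both branches are `flip`, so the foot of the ladder is set to 1.
  [cGate (.inl t) (.inr none) fun _ => flip] ++ mcInner t M S none ++
    Circuit.inv [cGate (.inl t) (.inr none) fun _ => flip]

theorem mcInner_length (t : β) (M : unitaryGroup Bool ℂ) (l : List β) (c : Option β) :
    (mcInner t M l c).length = 8 * l.length + 1 := by
  induction l generalizing c with
  | nil => rfl
  | cons w l ih =>
    simp only [mcInner, List.length_append, ih, Circuit.inv, List.length_reverse, List.length_map,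
      andG, List.length_cons, List.length_nil]
    ring

theorem mc_length (S : List β) (t : β) (M : unitaryGroup Bool ℂ) :
    (mc S t M).length = 8 * S.length + 3 := by
  simp only [mc, List.length_append, mcInner_length, Circuit.inv, List.length_reverse,
    List.length_map, List.length_cons, List.length_nil]
  ring

variable [Fintype β]

/-- The rung `some w` stores the conjunction of the previous rung with the vanishing of `w`, so that
the last rung alone controls `M`. -/
theorem mcInner_mulVec (t : β) (M : unitaryGroup Bool ℂ) (l : List β) (c : Option β)
    (hl : l.Nodup) (ht : t ∉ l) (hc : ∀ w ∈ l, c ≠ some w) (v : (β ⊕ Option β → Bool) → ℂ)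
    (hv : ∀ s, v s ≠ 0 → ∀ w ∈ l, s (.inr (some w)) = false) (s : β ⊕ Option β → Bool) :
    ((mcInner t M l c).eval *ᵥ v) s =
      if s (.inr c) = true ∧ ∀ w ∈ l, s (.inl w) = false then
        ∑ b, (M : Matrix Bool Bool ℂ) (s (.inl t)) b * v (Function.update s (.inl t) b)
      else v s := by
  induction l generalizing c v s with
  | nil =>
    rw [mcInner, Circuit.eval_singleton, cGate_eval (by simp), uc_mulVec]
    simp only [ne_eq, reduceCtorEq, not_false_eq_true, Function.update_of_ne, List.not_mem_nil,
      false_implies, implies_true, and_true]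
    split_ifs with h
    · rfl
    · simp only [UnitaryGroup.one_val, Matrix.one_apply, ite_mul, one_mul, zero_mul,
        Finset.sum_ite_eq, Finset.mem_univ, if_true, Function.update_eq_self]
  | cons w l ih =>
    have hw : Sum.inl w ≠ (Sum.inr (some w) : β ⊕ Option β) := by simp
    have hcw : Sum.inr c ≠ (Sum.inr (some w) : β ⊕ Option β) := by simpa using hc w (by simp)
    rw [mcInner, Circuit.eval_append, Circuit.eval_append, Circuit.eval_inv, andG_eval hcw hw,
      ← mulVec_mulVec, ← mulVec_mulVec]
    have htw : t ≠ w := fun h => ht (by simp [h])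
    rw [conj_uc_flip_mulVec (a := .inr (some w)) (t := .inl t) (by simp)
      (fun s => s (.inr c) && !s (.inl w)) ?_ ?_ (fun s => ∀ w ∈ l, s (.inl w) = false) ?_
      (M : Matrix Bool Bool ℂ) v (fun s h => hv s h w (by simp)) (mcInner t M l (some w)).eval]
    · simp only [Bool.and_eq_true, Bool.not_eq_true', List.forall_mem_cons, and_assoc]
    · intro v₁ hv₁ s
      refine ih (some w) hl.of_cons (fun h => ht (by simp [h])) ?_ v₁ ?_ s
      · intro w' hw' h
        obtain rfl : w = w' := by simpa using h
        exact (List.nodup_cons.1 hl).1 hw'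
      · intro s hs w' hw'
        have hne : w' ≠ w := by
          rintro rfl
          exact (List.nodup_cons.1 hl).1 hw'
        rw [hv₁, uc_flip_mulVec _ _ _ _ fun s h => hv s h w (by simp)] at hs
        · have h2 : v (Function.update s (.inr (some w)) false) ≠ 0 := by
            intro h0
            simp [h0] at hs
          have := hv _ h2 w' (by simp [hw'])
          rwa [Function.update_of_ne (by simpa using hne)] at this
        · intro s b
          rw [Function.update_of_ne hcw, Function.update_of_ne hw]
    · intro s b
      simp only [Function.update_of_ne hcw, Function.update_of_ne hw]
    · intro s b
      rw [Function.update_of_ne (by simp), Function.update_of_ne (by simpa using htw.symm)]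
    · intro s b
      simp

/-- The vector `ψ`, with all the qubits of the ladder in the state `0`. -/
def emb (ψ : (β → Bool) → ℂ) : (β ⊕ Option β → Bool) → ℂ :=
  fun s => if ∀ o, s (.inr o) = false then ψ (s ∘ Sum.inl) else 0

/-- On the vectors whose ladder qubits are `0`, the operator `U` acts as `T`. -/
def Impl (U : Matrix (β ⊕ Option β → Bool) (β ⊕ Option β → Bool) ℂ)
    (T : Matrix (β → Bool) (β → Bool) ℂ) : Prop :=
  ∀ ψ, U *ᵥ emb ψ = emb (T *ᵥ ψ)

theorem Impl.mul {U U' : Matrix (β ⊕ Option β → Bool) (β ⊕ Option β → Bool) ℂ}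
    {T T' : Matrix (β → Bool) (β → Bool) ℂ} (h : Impl U T) (h' : Impl U' T') :
    Impl (U * U') (T * T') := by
  intro ψ
  rw [← mulVec_mulVec, h', h, mulVec_mulVec]

/-- Unitarity of `T` makes every clean vector the image of a clean one, so `star U` leaves the
ladder clean as well. -/
theorem Impl.star {U : Matrix (β ⊕ Option β → Bool) (β ⊕ Option β → Bool) ℂ}
    (hU : U ∈ unitaryGroup (β ⊕ Option β → Bool) ℂ) {T : unitaryGroup (β → Bool) ℂ}
    (h : Impl U T) : Impl (star U) (T⁻¹ : unitaryGroup (β → Bool) ℂ) := by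
  intro ψ
  have h1 := h ((T⁻¹ : unitaryGroup (β → Bool) ℂ) *ᵥ ψ)
  have h2 : (T : Matrix (β → Bool) (β → Bool) ℂ) *
      ((T⁻¹ : unitaryGroup (β → Bool) ℂ) : Matrix (β → Bool) (β → Bool) ℂ) = 1 := by
    rw [← UnitaryGroup.mul_val, mul_inv_cancel, UnitaryGroup.one_val]
  rw [mulVec_mulVec, h2, one_mulVec] at h1
  rw [← h1, mulVec_mulVec, Matrix.mem_unitaryGroup_iff'.1 hU, one_mulVec]

theorem Impl.uc {t : β} {M' : (β ⊕ Option β → Bool) → unitaryGroup Bool ℂ}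
    {M : (β → Bool) → unitaryGroup Bool ℂ}
    (h : ∀ s, (∀ o, s (.inr o) = false) → M' s = M (s ∘ Sum.inl)) :
    Impl (uc (.inl t) M') (uc t M) := by
  intro ψ
  funext s
  rw [uc_mulVec]
  have hcomp : ∀ b, Function.update s (.inl t) b ∘ Sum.inl =
      Function.update (s ∘ Sum.inl) t b := by
    intro b
    funext w
    by_cases hw : w = t
    · subst hw; simp
    · simp [hw]
  by_cases hs : ∀ o, s (.inr o) = false
  · have hs' : ∀ b o, Function.update s (.inl t) b (.inr o) = false := by
      simpa using hs
    simp only [emb, hs, hs', implies_true, if_true, hcomp, uc_mulVec]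
    rw [h _ (hs' _), hcomp]
    rfl
  · have hs' : ∀ b, ¬ ∀ o, Function.update s (.inl t) b (.inr o) = false := by
      simpa using hs
    simp only [emb, if_neg hs, if_neg (hs' _), mul_zero, Finset.sum_const_zero]

theorem mc_impl (S : List β) (t : β) (M : unitaryGroup Bool ℂ) (hS : S.Nodup) (ht : t ∉ S) :
    Impl (mc S t M).eval (QCirc.uc t fun s => if ∀ w ∈ S, s w = false then M else 1) := by
  intro ψ
  have key : (mc S t M).eval *ᵥ emb ψ =
      QCirc.uc (.inl t) (fun s => if ∀ w ∈ S, s (.inl w) = false then M else 1) *ᵥ emb ψ := by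
    have he : (Circuit.eval [cGate (.inl t) (.inr none) fun _ => flip] :
        Matrix (β ⊕ Option β → Bool) (β ⊕ Option β → Bool) ℂ)
        = QCirc.uc (.inr none) fun s => if (fun _ => true) s then flip else 1 := by
      rw [Circuit.eval_singleton, cGate_eval (by simp)]
      simp
    have hv : ∀ s : β ⊕ Option β → Bool, emb ψ s ≠ 0 → ∀ o, s (.inr o) = false := by
      intro s hs
      by_contra h
      exact hs (if_neg h)
    funext s
    rw [mc, Circuit.eval_append, Circuit.eval_append, Circuit.eval_inv, he, ← mulVec_mulVec,
      ← mulVec_mulVec]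
    rw [conj_uc_flip_mulVec (a := .inr none) (t := .inl t) (by simp) (fun _ => true)
      (fun _ _ => rfl) (fun _ _ => rfl) (fun s => ∀ w ∈ S, s (.inl w) = false) ?_
      (M : Matrix Bool Bool ℂ) (emb ψ) (fun s h => hv s h none) (mcInner t M S none).eval]
    · have hu : ∀ w ∈ S, Function.update s (.inl t) false (.inl w) = s (.inl w) := by
        intro w hw
        rw [Function.update_of_ne]
        simp only [ne_eq, Sum.inl.injEq]
        rintro rfl
        exact ht hw
      rw [uc_mulVec]
      have hu' : (∀ w ∈ S, Function.update s (.inl t) false (.inl w) = false) ↔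
          ∀ w ∈ S, s (.inl w) = false :=
        forall₂_congr fun w hw => by rw [hu w hw]
      simp only [hu', true_and]
      split_ifs with h
      · rfl
      · simp only [UnitaryGroup.one_val, Matrix.one_apply, ite_mul, one_mul, zero_mul,
          Finset.sum_ite_eq, Finset.mem_univ, if_true, Function.update_eq_self]
    · intro v₁ hv₁ s
      refine mcInner_mulVec t M S none hS ht (by simp) v₁ ?_ s
      intro s hs w _
      rw [hv₁, uc_flip_mulVec _ _ (fun _ _ => rfl) _ fun s h => hv s h none] at hs
      have h2 : emb ψ (Function.update s (.inr none) false) ≠ 0 := by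
        intro h0
        simp [h0] at hs
      simpa using hv _ h2 (some w)
    · intro s b
      simp
  rw [key]
  exact Impl.uc (t := t) (M' := fun s => if ∀ w ∈ S, s (.inl w) = false then M else 1)
    (M := fun s => if ∀ w ∈ S, s w = false then M else 1)
    (fun s _ => by simp only [Function.comp_apply]) ψ

theorem Impl.opOn {V : Type} [Fintype V] [DecidableEq V] (e : V ↪ β)
    (M : Matrix (V → Bool) (V → Bool) ℂ) :
    Impl (opOn (e.trans Function.Embedding.inl) M : Matrix (β ⊕ Option β → Bool) _ ℂ)
      (opOn e M) := by
  intro ψ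
  have hmv : ∀ {W : Type} [Fintype W] [DecidableEq W] (e : V ↪ W) (v : (W → Bool) → ℂ) (s),
      (QCirc.opOn e M *ᵥ v) s = ∑ a, M (s ∘ e) a * v (Function.extend e a s) :=
    fun e v s => opOn_mul_apply e M (fun s (_ : Unit) => v s) s ()
  funext s
  rw [hmv]
  have hr : ∀ a o, Function.extend (e.trans Function.Embedding.inl) a s (.inr o) = s (.inr o) := by
    intro a o
    refine extend_off _ _ _ ?_
    rintro ⟨v, hv⟩
    simp at hv
  have hl : ∀ a, Function.extend (e.trans Function.Embedding.inl) a s ∘ Sum.inl =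
      Function.extend e a (s ∘ Sum.inl) := by
    intro a
    funext w
    by_cases hw : w ∈ Set.range e
    · obtain ⟨v, rfl⟩ := hw
      rw [e.injective.extend_apply]
      exact (e.trans Function.Embedding.inl).injective.extend_apply a s v
    · rw [extend_off e _ _ hw]
      refine extend_off _ _ _ ?_
      rintro ⟨v, hv⟩
      exact hw ⟨v, by simpa using hv⟩
  simp only [emb, hr, hl, hmv]
  by_cases hs : ∀ o, s (.inr o) = false
  · simp only [hs, implies_true, if_true]
    rfl
  · simp only [hs, if_false, mul_zero, Finset.sum_const_zero]

end Ladder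

/-! ### Operators that preserve the values of some qubits -/

section Fixing

variable {β : Type} [Fintype β] [DecidableEq β]

/-- The unitaries that preserve the values of the qubits in `Φ`. -/
def fixing (Φ : Set β) : Subgroup (unitaryGroup (β → Bool) ℂ) where
  carrier := {T | ∀ s s', (T : Matrix (β → Bool) (β → Bool) ℂ) s s' ≠ 0 → ∀ w ∈ Φ, s w = s' w}
  one_mem' := by
    intro s s' h
    have : s = s' := by
      by_contra hne
      exact h (Matrix.one_apply_ne hne)
    simp [this]
  mul_mem' := by
    intro A B hA hB s s' h w hw
    rw [UnitaryGroup.mul_val, Matrix.mul_apply] at h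
    obtain ⟨r, -, hr⟩ := Finset.exists_ne_zero_of_sum_ne_zero h
    rw [hA s r (left_ne_zero_of_mul hr) w hw, hB r s' (right_ne_zero_of_mul hr) w hw]
  inv_mem' := by
    intro A hA s s' h w hw
    rw [UnitaryGroup.inv_val, Matrix.star_apply, star_ne_zero] at h
    exact (hA s' s h w hw).symm

theorem eq_of_mem_fixing {Φ : Set β} {T : unitaryGroup (β → Bool) ℂ} (hT : T ∈ fixing Φ)
    {s s' : β → Bool} (h : (T : Matrix (β → Bool) (β → Bool) ℂ) s s' ≠ 0) {w : β} (hw : w ∈ Φ) :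
    s w = s' w := hT s s' h w hw

theorem ucU_mem_fixing {Φ : Set β} {t : β} (ht : t ∉ Φ)
    (M : (β → Bool) → unitaryGroup Bool ℂ) : ucU t M ∈ fixing Φ := by
  intro s s' h w hw
  by_contra hne
  refine h (if_neg fun h' => hne (h' w ?_))
  rintro rfl
  exact ht hw

theorem opOnU_mem_fixing {V : Type} [Fintype V] [DecidableEq V] {Φ : Set β} (e : V ↪ β)
    (he : ∀ v, e v ∉ Φ) (M : unitaryGroup (V → Bool) ℂ) : opOnU e M ∈ fixing Φ := by
  classical
  intro s s' h w hw
  by_contra hne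
  refine h ?_
  change opOn e _ s s' = 0
  rw [opOn_apply, if_neg]
  intro h'
  refine hne (h' w ?_)
  rintro ⟨v, rfl⟩
  exact he v hw

theorem uc_ph_mul_apply {κ' : Type} (t : β) (b : Bool) (α : Circle) (κ : (β → Bool) → Prop)
    [DecidablePred κ] (hκ : ∀ s b, κ (Function.update s t b) ↔ κ s)
    (X : Matrix (β → Bool) κ' ℂ) (s : β → Bool) (r : κ') :
    (uc t (fun s => if κ s then ph b α else 1) * X) s r =
      (if κ s ∧ s t = b then (α : ℂ) else 1) * X s r := by
  rw [uc_mul_apply]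
  simp only [hκ]
  by_cases h1 : κ s
  · simp only [h1, if_true, true_and, ph_apply, ite_mul, zero_mul, Finset.sum_ite_eq,
      Finset.mem_univ, Function.update_eq_self]
  · simp only [h1, if_false, false_and, UnitaryGroup.one_val, Matrix.one_apply, ite_mul, one_mul,
      zero_mul, Finset.sum_ite_eq, Finset.mem_univ, if_true, Function.update_eq_self]

/-! ### Amplitude amplification with general phases -/

/-- The probability of the value `b` of the qubit `h` in the state `T |σ⟩`. -/
def prob (T : unitaryGroup (β → Bool) ℂ) (h : β) (b : Bool) (σ : β → Bool) : ℝ :=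
  ∑ s with s h = b, ‖(T : Matrix (β → Bool) (β → Bool) ℂ) s σ‖ ^ 2

theorem sum_norm_sq (T : unitaryGroup (β → Bool) ℂ) (σ : β → Bool) :
    ∑ s, ‖(T : Matrix (β → Bool) (β → Bool) ℂ) s σ‖ ^ 2 = 1 := by
  have h : (star (T : Matrix (β → Bool) (β → Bool) ℂ) * (T : Matrix (β → Bool) (β → Bool) ℂ)) σ σ
      = 1 := by
    rw [UnitaryGroup.star_mul_self, Matrix.one_apply_eq]
  rw [Matrix.mul_apply] at h
  have h2 : ∀ s, star (T : Matrix (β → Bool) (β → Bool) ℂ) σ s *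
      (T : Matrix (β → Bool) (β → Bool) ℂ) s σ =
        ((‖(T : Matrix (β → Bool) (β → Bool) ℂ) s σ‖ ^ 2 : ℝ) : ℂ) := by
    intro s
    rw [Matrix.star_apply]
    push_cast
    exact Complex.conj_mul' _
  simp only [h2] at h
  exact_mod_cast h

theorem prob_add (T : unitaryGroup (β → Bool) ℂ) (h : β) (b : Bool) (σ : β → Bool) :
    prob T h b σ + prob T h (!b) σ = 1 := by
  rw [← sum_norm_sq T σ, prob, prob,
    ← Finset.sum_filter_add_sum_filter_not Finset.univ (fun s : β → Bool => s h = b)]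
  congr 2
  ext s
  cases s h <;> cases b <;> simp

theorem prob_nonneg (T : unitaryGroup (β → Bool) ℂ) (h : β) (b : Bool) (σ : β → Bool) :
    0 ≤ prob T h b σ := Finset.sum_nonneg fun _ _ => by positivity

theorem prob_le_one (T : unitaryGroup (β → Bool) ℂ) (h : β) (b : Bool) (σ : β → Bool) :
    prob T h b σ ≤ 1 := by
  linarith [prob_add T h b σ, prob_nonneg T h (!b) σ]

/-- One step of amplitude amplification: the phase `q.2` is applied to the states in which the
qubits `t :: S` are `0`, and to those in which the qubit `h` has the value `q.1`. -/
def ampStep (S : List β) (t h : β) (T : unitaryGroup (β → Bool) ℂ) (q : Bool × Circle) :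
    unitaryGroup (β → Bool) ℂ :=
  T * (ucU t (fun s => if ∀ w ∈ S, s w = false then ph false q.2 else 1) *
    (T⁻¹ * (ucU h (fun _ => ph q.1 q.2) * T)))

variable {S : List β} {t h : β} {Φ : Set β} {T : unitaryGroup (β → Bool) ℂ}

theorem ampStep_mem_fixing (hZ : ∀ w, w ∈ t :: S ↔ w ∉ Φ) (hh : h ∉ Φ) (hT : T ∈ fixing Φ)
    (q : Bool × Circle) : ampStep S t h T q ∈ fixing Φ :=
  mul_mem hT (mul_mem (ucU_mem_fixing ((hZ t).1 (by simp)) _)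
    (mul_mem (inv_mem hT) (mul_mem (ucU_mem_fixing hh _) hT)))

/-- The vector X|σ⟩, with X = T⁻¹ R T, has the values of σ on `Φ`, so its only component that
vanishes off `Φ` is the one at σ itself. The phase on zero states thus subtracts a multiple of |σ⟩,
which `T` maps to the same multiple of T|σ⟩; the entry of X at σ is 1 - (1 - α)p. -/
theorem ampStep_apply (hZ : ∀ w, w ∈ t :: S ↔ w ∉ Φ) (ht : t ∉ S) (hh : h ∉ Φ)
    (hT : T ∈ fixing Φ) (b : Bool) (α : Circle) {σ : β → Bool} (hσ : ∀ w, w ∉ Φ → σ w = false)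
    (s : β → Bool) :
    (ampStep S t h T (b, α) : Matrix (β → Bool) (β → Bool) ℂ) s σ =
      ((if s h = b then (α : ℂ) else 1) -
        (1 - α) * (1 - (1 - α) * (prob T h b σ : ℂ))) *
          (T : Matrix (β → Bool) (β → Bool) ℂ) s σ := by
  set R : unitaryGroup (β → Bool) ℂ := ucU h (fun _ => ph b α) with hR
  set X : unitaryGroup (β → Bool) ℂ := T⁻¹ * (R * T) with hX
  have hXΦ : X ∈ fixing Φ := mul_mem (inv_mem hT) (mul_mem (ucU_mem_fixing hh _) hT)
  have hRT : ∀ s, ((R * T : unitaryGroup (β → Bool) ℂ) : Matrix (β → Bool) (β → Bool) ℂ) s σ =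
      (if s h = b then (α : ℂ) else 1) * (T : Matrix (β → Bool) (β → Bool) ℂ) s σ := by
    intro s
    have := uc_ph_mul_apply h b α (fun _ => True) (fun _ _ => Iff.rfl)
      (T : Matrix (β → Bool) (β → Bool) ℂ) s σ
    simp only [if_true, true_and] at this
    exact this
  have hTX : (T * X : unitaryGroup (β → Bool) ℂ) = R * T := by simp [hX]
  have hXσ : (X : Matrix (β → Bool) (β → Bool) ℂ) σ σ = 1 - (1 - α) * (prob T h b σ : ℂ) := by
    rw [hX, UnitaryGroup.mul_val, Matrix.mul_apply]
    have h1 : ∀ s, (T⁻¹ : unitaryGroup (β → Bool) ℂ).1 σ s *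
        ((R * T : unitaryGroup (β → Bool) ℂ) : Matrix (β → Bool) (β → Bool) ℂ) s σ =
        ((‖(T : Matrix (β → Bool) (β → Bool) ℂ) s σ‖ ^ 2 : ℝ) : ℂ) - (1 - α) *
          (if s h = b then ((‖(T : Matrix (β → Bool) (β → Bool) ℂ) s σ‖ ^ 2 : ℝ) : ℂ) else 0) := by
      intro s
      have h2 : (star ((T : Matrix (β → Bool) (β → Bool) ℂ) s σ)) *
          (T : Matrix (β → Bool) (β → Bool) ℂ) s σ =
          ((‖(T : Matrix (β → Bool) (β → Bool) ℂ) s σ‖ ^ 2 : ℝ) : ℂ) := by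
        push_cast
        exact Complex.conj_mul' _
      rw [hRT, UnitaryGroup.inv_val, Matrix.star_apply, ← h2]
      split_ifs <;> ring
    rw [Finset.sum_congr rfl fun s _ => h1 s, Finset.sum_sub_distrib, ← Finset.mul_sum,
      ← Complex.ofReal_sum, sum_norm_sq, ← Finset.sum_filter, ← Complex.ofReal_sum]
    simp [prob]
  have hRs : ∀ s, (((ucU t (fun s => if ∀ w ∈ S, s w = false then ph false α else 1)) * X :
      unitaryGroup (β → Bool) ℂ) : Matrix (β → Bool) (β → Bool) ℂ) s σ =
      (X : Matrix (β → Bool) (β → Bool) ℂ) s σ -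
        if s = σ then (1 - α) * (X : Matrix (β → Bool) (β → Bool) ℂ) σ σ else 0 := by
    intro s
    have h1 := uc_ph_mul_apply t false α (fun s => ∀ w ∈ S, s w = false) (by
      intro s b
      refine forall₂_congr fun w hw => ?_
      rw [Function.update_of_ne]
      rintro rfl
      exact ht hw) (X : Matrix (β → Bool) (β → Bool) ℂ) s σ
    have h2 : ((∀ w ∈ S, s w = false) ∧ s t = false) ↔ ∀ w, w ∉ Φ → s w = false := by
      simp only [← hZ, List.forall_mem_cons]
      exact and_comm
    refine h1.trans ?_
    by_cases hs : s = σ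
    · subst hs
      rw [if_pos (h2.2 hσ), if_pos rfl]
      ring
    · rw [if_neg hs, sub_zero]
      by_cases h3 : ∀ w, w ∉ Φ → s w = false
      · rw [if_pos (h2.2 h3)]
        have : (X : Matrix (β → Bool) (β → Bool) ℂ) s σ = 0 := by
          by_contra h0
          refine hs (funext fun w => ?_)
          by_cases hw : w ∈ Φ
          · exact eq_of_mem_fixing hXΦ h0 hw
          · rw [h3 w hw, hσ w hw]
        rw [this, mul_zero]
      · rw [if_neg fun h => h3 (h2.1 h), one_mul]
  have h4 : (ampStep S t h T (b, α) : Matrix (β → Bool) (β → Bool) ℂ) s σ =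
      ((T * X : unitaryGroup (β → Bool) ℂ) : Matrix (β → Bool) (β → Bool) ℂ) s σ -
        (T : Matrix (β → Bool) (β → Bool) ℂ) s σ *
          ((1 - α) * (X : Matrix (β → Bool) (β → Bool) ℂ) σ σ) := by
    rw [ampStep, UnitaryGroup.mul_val, Matrix.mul_apply, UnitaryGroup.mul_val T X,
      Matrix.mul_apply, Finset.sum_congr rfl fun r _ => congrArg _ (hRs r)]
    simp only [mul_sub, Finset.sum_sub_distrib, mul_ite, mul_zero, Finset.sum_ite_eq',
      Finset.mem_univ, if_true]
  rw [h4, hTX, hRT, hXσ]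
  ring

/-- A phase `α` with `(1 - α)² = - α c`. -/
def phase (c : ℝ) : Circle := Classical.epsilon fun α : Circle => (1 - (α : ℂ)) ^ 2 = -α * c

/-- On the unit circle the equation says |1 - α|² = c, that is, Re α = 1 - c/2. -/
theorem phase_spec {c : ℝ} (h0 : 0 ≤ c) (h4 : c ≤ 4) :
    (1 - (phase c : ℂ)) ^ 2 = -(phase c : ℂ) * c := by
  refine Classical.epsilon_spec (p := fun α : Circle => (1 - (α : ℂ)) ^ 2 = -α * c) ?_
  have h1 : 0 ≤ 1 - (1 - c / 2) ^ 2 := by nlinarith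
  have h2 := Real.sq_sqrt h1
  generalize √(1 - (1 - c / 2) ^ 2) = r at h2
  refine ⟨⟨⟨1 - c / 2, r⟩, mem_sphere_zero_iff_norm.2 ?_⟩, ?_⟩
  · rw [← sq_eq_sq₀ (norm_nonneg _) (by norm_num), Complex.sq_norm,
      Complex.normSq_mk]
    nlinarith
  · apply Complex.ext
    · simp [pow_two]
      nlinarith
    · simp [pow_two]
      ring

/-- Off the target value the factor in `ampStep_apply` is α + (1 - α)² p = α(1 - cp), a real number
up to a phase. -/
theorem prob_ampStep (hZ : ∀ w, w ∈ t :: S ↔ w ∉ Φ) (ht : t ∉ S) (hh : h ∉ Φ)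
    (hT : T ∈ fixing Φ) (b : Bool) {c : ℝ} (h0 : 0 ≤ c) (h4 : c ≤ 4) {σ : β → Bool}
    (hσ : ∀ w, w ∉ Φ → σ w = false) :
    prob (ampStep S t h T (b, phase c)) h (!b) σ =
      prob T h (!b) σ * (1 - c * prob T h b σ) ^ 2 := by
  rw [prob, prob, Finset.sum_mul]
  refine Finset.sum_congr rfl fun s hs => ?_
  have hs' : s h ≠ b := by
    simp only [Finset.mem_filter, Finset.mem_univ, true_and] at hs
    simp [hs]
  rw [ampStep_apply hZ ht hh hT b _ hσ, if_neg hs']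
  have : (1 : ℂ) - (1 - phase c) * (1 - (1 - phase c) * (prob T h b σ : ℂ)) =
      phase c * ((1 - c * prob T h b σ : ℝ) : ℂ) := by
    push_cast
    linear_combination (prob T h b σ : ℂ) * phase_spec h0 h4
  rw [this, norm_mul, norm_mul, Circle.norm_coe, one_mul, mul_pow, Complex.norm_real,
    Real.norm_eq_abs, sq_abs, mul_comm]

/-- The scalar does not depend on `s`, so amplification preserves the ratios of the amplitudes on
the target. As 1 - (1 - α)p is a convex combination of 1 and α, the scalar has modulus at most 1 + 2
· 1. -/
theorem ampStep_eq_mul (hZ : ∀ w, w ∈ t :: S ↔ w ∉ Φ) (ht : t ∉ S) (hh : h ∉ Φ)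
    (hT : T ∈ fixing Φ) (b : Bool) (α : Circle) {σ : β → Bool}
    (hσ : ∀ w, w ∉ Φ → σ w = false) :
    ∃ z : ℂ, ‖z‖ ≤ 3 ∧ ∀ s, s h = b →
      (ampStep S t h T (b, α) : Matrix (β → Bool) (β → Bool) ℂ) s σ =
        z * (T : Matrix (β → Bool) (β → Bool) ℂ) s σ := by
  refine ⟨α - (1 - α) * (1 - (1 - α) * (prob T h b σ : ℂ)), ?_, fun s hs => ?_⟩
  · have hp0 := prob_nonneg T h b σ
    have hp1 := prob_le_one T h b σ
    have h1 : ‖(1 : ℂ) - α‖ ≤ 2 := by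
      refine (norm_sub_le _ _).trans ?_
      rw [norm_one, Circle.norm_coe]
      norm_num
    have h2 : ‖(1 : ℂ) - (1 - α) * (prob T h b σ : ℂ)‖ ≤ 1 := by
      have : (1 : ℂ) - (1 - α) * (prob T h b σ : ℂ) =
          ((1 - prob T h b σ : ℝ) : ℂ) + α * (prob T h b σ : ℝ) := by
        push_cast; ring
      rw [this]
      refine (norm_add_le _ _).trans ?_
      rw [norm_mul, Circle.norm_coe, Complex.norm_real, Complex.norm_real, Real.norm_eq_abs,
        Real.norm_eq_abs, abs_of_nonneg (by linarith), abs_of_nonneg hp0]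
      linarith
    refine (norm_sub_le _ _).trans ?_
    rw [Circle.norm_coe, norm_mul]
    nlinarith [norm_nonneg ((1 : ℂ) - α), norm_nonneg ((1 : ℂ) - (1 - α) * (prob T h b σ : ℂ))]
  · rw [ampStep_apply hZ ht hh hT b _ hσ, if_pos hs]

/-! ### Gap amplification -/

/-- The phases that drive probabilities of the value `1` to `0` or to `1`. -/
def gapList : ℕ → List (Bool × Circle)
  -- The raising step comes first: 2/3 goes to (26/27)³ > 22/25, while 1/3 rises only to (19/27)³ <
  -- 7/20. Lowering first would take 2/3 down to 8/27.
  | 0 => [(true, phase 1), (false, phase 1)]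
  | r + 1 => gapList r ++ [(false, phase 1), (true, phase 1)]

theorem gapList_length (r : ℕ) : (gapList r).length = 2 * r + 2 := by
  induction r with
  | zero => rfl
  | succ r ih => simp [gapList, ih]; ring

theorem foldl_ampStep_mem_fixing (hZ : ∀ w, w ∈ t :: S ↔ w ∉ Φ) (hh : h ∉ Φ) (hT : T ∈ fixing Φ)
    (l : List (Bool × Circle)) : l.foldl (ampStep S t h) T ∈ fixing Φ := by
  induction l generalizing T with
  | nil => exact hT
  | cons q l ih => exact ih (ampStep_mem_fixing hZ hh hT q)

/-- With c = 1 the factor (1 - p)² turns the miss probability 1 - p into its cube. -/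
theorem prob_ampStep_true (hZ : ∀ w, w ∈ t :: S ↔ w ∉ Φ) (ht : t ∉ S) (hh : h ∉ Φ)
    (hT : T ∈ fixing Φ) {σ : β → Bool} (hσ : ∀ w, w ∉ Φ → σ w = false) :
    prob (ampStep S t h T (true, phase 1)) h true σ = 1 - (1 - prob T h true σ) ^ 3 := by
  have h1 := prob_ampStep hZ ht hh hT true (c := 1) (by norm_num) (by norm_num) hσ
  have h2 := prob_add T h true σ
  have h3 := prob_add (ampStep S t h T (true, phase 1)) h true σ
  have h4 : prob T h (!true) σ = 1 - prob T h true σ := by linarith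
  rw [h4] at h1
  linear_combination h3 - h1

theorem prob_ampStep_false (hZ : ∀ w, w ∈ t :: S ↔ w ∉ Φ) (ht : t ∉ S) (hh : h ∉ Φ)
    (hT : T ∈ fixing Φ) {σ : β → Bool} (hσ : ∀ w, w ∉ Φ → σ w = false) :
    prob (ampStep S t h T (false, phase 1)) h true σ = prob T h true σ ^ 3 := by
  have h1 := prob_ampStep hZ ht hh hT false (c := 1) (by norm_num) (by norm_num) hσ
  have h2 := prob_add T h true σ
  rw [Bool.not_true] at h2
  have h4 : prob T h false σ = 1 - prob T h true σ := by linarith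
  rw [h4] at h1
  simp only [Bool.not_false] at h1
  rw [h1]
  ring

/-- A pair of steps sends p to 1 - (1 - p³)³ ≤ 4p³, so 2p is at most cubed. The exponent triples
while the number of oracle calls grows ninefold, which keeps the overhead polynomial in the
exponent. -/
theorem prob_gap_small (hZ : ∀ w, w ∈ t :: S ↔ w ∉ Φ) (ht : t ∉ S) (hh : h ∉ Φ)
    (hT : T ∈ fixing Φ) {σ : β → Bool} (hσ : ∀ w, w ∉ Φ → σ w = false)
    (hp : prob T h true σ ≤ 1 / 3) (r : ℕ) :
    2 * prob ((gapList (r + 1)).foldl (ampStep S t h) T) h true σ ≤ (1 / 4) ^ 3 ^ r := by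
  induction r with
  | zero =>
    -- Starting from at most 1/3, the first four steps end at or below 1 - (1 - (19/27)⁹)³ < 1/8.
    simp only [gapList, List.foldl_append, List.foldl_cons, List.foldl_nil]
    have m1 := ampStep_mem_fixing hZ hh hT (true, phase 1)
    have m2 := ampStep_mem_fixing hZ hh m1 (false, phase 1)
    have m3 := ampStep_mem_fixing hZ hh m2 (false, phase 1)
    rw [prob_ampStep_true hZ ht hh m3 hσ, prob_ampStep_false hZ ht hh m2 hσ,
      prob_ampStep_false hZ ht hh m1 hσ, prob_ampStep_true hZ ht hh hT hσ]
    have h0 := prob_nonneg T h true σ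
    generalize prob T h true σ = p at *
    have a1 : (2 / 3) ^ 3 ≤ (1 - p) ^ 3 := pow_le_pow_left₀ (by norm_num) (by linarith) 3
    have a2 : (1 - p) ^ 3 ≤ 1 := pow_le_one₀ (by linarith) (by linarith)
    have a3 : ((1 - (1 - p) ^ 3) ^ 3) ^ 3 ≤ ((19 / 27) ^ 3) ^ 3 := by
      gcongr
      linarith
    have a4 : (1 - ((19 / 27 : ℝ) ^ 3) ^ 3) ^ 3 ≤ (1 - ((1 - (1 - p) ^ 3) ^ 3) ^ 3) ^ 3 :=
      pow_le_pow_left₀ (by norm_num) (by linarith) 3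
    norm_num at a4 ⊢
    linarith
  | succ r ih =>
    rw [gapList, List.foldl_append]
    simp only [List.foldl_cons, List.foldl_nil]
    have m1 := foldl_ampStep_mem_fixing hZ hh hT (gapList (r + 1))
    have m2 := ampStep_mem_fixing hZ hh m1 (false, phase 1)
    rw [prob_ampStep_true hZ ht hh m2 hσ, prob_ampStep_false hZ ht hh m1 hσ, pow_succ 3 r, pow_mul]
    have h00 := prob_le_one ((gapList (r + 1)).foldl (ampStep S t h) T) h true σ
    have h0 := prob_nonneg ((gapList (r + 1)).foldl (ampStep S t h) T) h true σ
    generalize prob ((gapList (r + 1)).foldl (ampStep S t h) T) h true σ = p at *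
    refine le_trans ?_ (pow_le_pow_left₀ (by linarith) ih 3)
    have h1 : 0 ≤ p ^ 3 := by positivity
    have h2 : p ^ 3 ≤ 1 := pow_le_one₀ h0 h00
    rw [mul_pow]
    generalize p ^ 3 = q at *
    nlinarith [mul_nonneg h1 h1, mul_nonneg (mul_nonneg h1 h1) (sub_nonneg.2 h2)]

/-- The first pair of steps reaches (26/27)³ > 22/25, and later pairs keep the bound because 1 - (1
- (22/25)³)³ > 22/25. -/
theorem prob_gap_large (hZ : ∀ w, w ∈ t :: S ↔ w ∉ Φ) (ht : t ∉ S) (hh : h ∉ Φ)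
    (hT : T ∈ fixing Φ) {σ : β → Bool} (hσ : ∀ w, w ∉ Φ → σ w = false)
    (hp : 2 / 3 ≤ prob T h true σ) (r : ℕ) :
    22 / 25 ≤ prob ((gapList r).foldl (ampStep S t h) T) h true σ := by
  induction r with
  | zero =>
    simp only [gapList, List.foldl_cons, List.foldl_nil]
    have m1 := ampStep_mem_fixing hZ hh hT (true, phase 1)
    rw [prob_ampStep_false hZ ht hh m1 hσ, prob_ampStep_true hZ ht hh hT hσ]
    have h1 := prob_le_one T h true σ
    generalize prob T h true σ = p at *
    have a1 : (1 - p) ^ 3 ≤ (1 / 3) ^ 3 := pow_le_pow_left₀ (by linarith) (by linarith) 3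
    have a2 : (26 / 27) ^ 3 ≤ (1 - (1 - p) ^ 3) ^ 3 :=
      pow_le_pow_left₀ (by norm_num) (by norm_num at a1 ⊢; linarith) 3
    norm_num at a2 ⊢
    linarith
  | succ r ih =>
    rw [gapList, List.foldl_append]
    simp only [List.foldl_cons, List.foldl_nil]
    have m1 := foldl_ampStep_mem_fixing hZ hh hT (gapList r)
    have m2 := ampStep_mem_fixing hZ hh m1 (false, phase 1)
    rw [prob_ampStep_true hZ ht hh m2 hσ, prob_ampStep_false hZ ht hh m1 hσ]
    have h1 := prob_le_one ((gapList r).foldl (ampStep S t h) T) h true σ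
    generalize prob ((gapList r).foldl (ampStep S t h) T) h true σ = p at *
    have a1 : (22 / 25) ^ 3 ≤ p ^ 3 := pow_le_pow_left₀ (by norm_num) ih 3
    have a2 : p ^ 3 ≤ 1 := pow_le_one₀ (by linarith) h1
    have a3 : (1 - p ^ 3) ^ 3 ≤ (1 - (22 / 25) ^ 3) ^ 3 :=
      pow_le_pow_left₀ (by linarith) (by linarith) 3
    norm_num at a3 ⊢
    linarith

/-! ### Fixed-point search -/

/-- The coefficient that amplifies by a Chebyshev polynomial of degree three. -/
def chebCoeff (x : ℝ) : ℝ := 4 * x ^ 2 / (4 * x ^ 2 - 3)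

/-- The phases of fixed-point search. -/
def chebList (u : ℝ) (m : ℕ) : List (Bool × Circle) :=
  (List.range m).map fun k => (true, phase (chebCoeff (Real.cosh (3 ^ k * u))))

theorem chebList_length (u : ℝ) (m : ℕ) : (chebList u m).length = m := by
  simp [chebList]

theorem foldl_chebList_succ (u : ℝ) (m : ℕ) :
    (chebList u (m + 1)).foldl (ampStep S t h) T =
      ampStep S t h ((chebList u m).foldl (ampStep S t h) T)
        (true, phase (chebCoeff (Real.cosh (3 ^ m * u)))) := by
  simp [chebList, List.range_succ]

/-- Let x be the current hyperbolic cosine, q the miss probability and y = x² q. Tripling the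
argument replaces x by T₃(x), and `chebCoeff` is chosen so that y becomes y(4y - 3)² = T₃(√y)². The
bound survives because |T₃| ≤ 1 on [-1, 1], however small q already is: this is the fixed-point
property. -/
theorem chebList_prob (hZ : ∀ w, w ∈ t :: S ↔ w ∉ Φ) (ht : t ∉ S) (hh : h ∉ Φ)
    (hT : T ∈ fixing Φ) {σ : β → Bool} (hσ : ∀ w, w ∉ Φ → σ w = false) (u : ℝ)
    (hu : Real.cosh u ^ 2 * prob T h false σ ≤ 1) (m : ℕ) :
    Real.cosh (3 ^ m * u) ^ 2 * prob ((chebList u m).foldl (ampStep S t h) T) h false σ ≤ 1 := by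
  induction m with
  | zero => simpa [chebList] using hu
  | succ m ih =>
    rw [foldl_chebList_succ, pow_succ' 3 m, mul_assoc, Real.cosh_three_mul]
    have m1 := foldl_ampStep_mem_fixing hZ hh hT (chebList u m)
    have hx := Real.one_le_cosh (3 ^ m * u)
    generalize Real.cosh (3 ^ m * u) = x at *
    have hx2 : 1 ≤ x ^ 2 := one_le_pow₀ hx
    have hc0 : 0 ≤ chebCoeff x := div_nonneg (by positivity) (by linarith)
    have hc4 : chebCoeff x ≤ 4 := by
      rw [chebCoeff, div_le_iff₀ (by linarith)]
      linarith
    have h1 := prob_ampStep hZ ht hh m1 true hc0 hc4 hσ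
    have h2 := prob_add ((chebList u m).foldl (ampStep S t h) T) h true σ
    have h3 := prob_nonneg ((chebList u m).foldl (ampStep S t h) T) h false σ
    simp only [Bool.not_true] at h1 h2
    rw [h1]
    rw [← eq_sub_iff_add_eq] at h2
    rw [h2]
    generalize prob ((chebList u m).foldl (ampStep S t h) T) h false σ = p at *
    have h5 : chebCoeff x * (4 * x ^ 2 - 3) = 4 * x ^ 2 :=
      div_mul_cancel₀ _ (by linarith)
    have h6 : (4 * x ^ 3 - 3 * x) ^ 2 * (p * (1 - chebCoeff x * (1 - p)) ^ 2) =
        (x ^ 2 * p) * (4 * (x ^ 2 * p) - 3) ^ 2 := by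
      have : (4 * x ^ 2 - 3) * (1 - chebCoeff x * (1 - p)) = 4 * (x ^ 2 * p) - 3 := by
        linear_combination (p - 1) * h5
      rw [← this]
      ring
    rw [h6]
    have h7 : 0 ≤ x ^ 2 * p := by positivity
    generalize x ^ 2 * p = y at *
    -- 1 - y(4y - 3)² = (1 - y)(1 - 4y)².
    nlinarith [mul_nonneg (sub_nonneg.2 ih) (sq_nonneg (1 - 4 * y))]

/-- This is the soundness side: all flagged states are treated alike, so an unwanted one gains at
most a factor 3^m in amplitude, even when there is nothing to find. -/
theorem chebList_eq_mul (hZ : ∀ w, w ∈ t :: S ↔ w ∉ Φ) (ht : t ∉ S) (hh : h ∉ Φ)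
    (hT : T ∈ fixing Φ) {σ : β → Bool} (hσ : ∀ w, w ∉ Φ → σ w = false) (u : ℝ) (m : ℕ) :
    ∃ z : ℂ, ‖z‖ ≤ 3 ^ m ∧ ∀ s, s h = true →
      (((chebList u m).foldl (ampStep S t h) T : unitaryGroup (β → Bool) ℂ) :
        Matrix (β → Bool) (β → Bool) ℂ) s σ = z * (T : Matrix (β → Bool) (β → Bool) ℂ) s σ := by
  induction m with
  | zero => exact ⟨1, by simp, by simp [chebList]⟩
  | succ m ih =>
    obtain ⟨z, hz, hz'⟩ := ih
    have m1 := foldl_ampStep_mem_fixing hZ hh hT (chebList u m)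
    obtain ⟨z', hz1, hz2⟩ := ampStep_eq_mul hZ ht hh m1 true
      (phase (chebCoeff (Real.cosh (3 ^ m * u)))) hσ
    refine ⟨z' * z, ?_, fun s hs => ?_⟩
    · rw [norm_mul, pow_succ']
      exact mul_le_mul hz1 hz (norm_nonneg _) (by norm_num)
    · rw [foldl_chebList_succ, hz2 s hs, hz' s hs, mul_assoc]

end Fixing

/-! ### Programs on a register with a ladder -/

section Programs

variable {V β : Type} [Fintype V] [DecidableEq V] [Fintype β] [DecidableEq β]

/-- On the vectors whose ladder qubits are `0`, the circuit `B` with the oracle `D` acts as `T`. -/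
def Realizes (D : Circuit V) (B : OracleCircuit V (β ⊕ Option β))
    (T : unitaryGroup (β → Bool) ℂ) : Prop := Impl (B.run D).eval T

variable {D : Circuit V} {B C : OracleCircuit V (β ⊕ Option β)}
  {T U : unitaryGroup (β → Bool) ℂ}

theorem Realizes.append (hB : Realizes D B T) (hC : Realizes D C U) :
    Realizes D (B ++ C) (U * T) := by
  rw [Realizes, OracleCircuit.run_append, Circuit.eval_append]
  exact hC.mul hB

theorem Realizes.inv (hB : Realizes D B T) : Realizes D B.inv T⁻¹ := by
  rw [Realizes, OracleCircuit.run_inv, Circuit.eval_inv]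
  exact hB.star (Circuit.eval_mem _)

theorem realizes_nil : Realizes D ([] : OracleCircuit V (β ⊕ Option β)) 1 := by
  intro ψ
  simp [OracleCircuit.run, Circuit.eval]

theorem realizes_cGate {c t : β} (h : c ≠ t) (M : Bool → unitaryGroup Bool ℂ) :
    Realizes D [.gate (cGate (.inl c) (.inl t) M)] (ucU t fun s => M (s c)) := by
  have h1 : OracleCircuit.run ([.gate (cGate (.inl c) (.inl t) M)] :
      OracleCircuit V (β ⊕ Option β)) D = [cGate (.inl c) (.inl t) M] := rfl
  rw [Realizes, h1, Circuit.eval_singleton, cGate_eval (by simpa using h)]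
  exact Impl.uc (fun s _ => rfl)

theorem realizes_cGate_const (t : β) (M : unitaryGroup Bool ℂ) :
    Realizes D [.gate (cGate (.inr none) (.inl t) fun _ => M)] (ucU t fun _ => M) := by
  have h1 : OracleCircuit.run ([.gate (cGate (.inr none) (.inl t) fun _ => M)] :
      OracleCircuit V (β ⊕ Option β)) D = [cGate (.inr none) (.inl t) fun _ => M] := rfl
  rw [Realizes, h1, Circuit.eval_singleton, cGate_eval (by simp)]
  exact Impl.uc (fun s _ => rfl)

theorem realizes_query (e : V ↪ β) :
    Realizes D [.query (e.trans Function.Embedding.inl)] (opOnU e D.evalU) := by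
  have h1 : OracleCircuit.run ([.query (e.trans Function.Embedding.inl)] :
      OracleCircuit V (β ⊕ Option β)) D = D.relabel (e.trans Function.Embedding.inl) := by
    simp [OracleCircuit.run, Instr.expand]
  rw [Realizes, h1, Circuit.eval_relabel]
  exact Impl.opOn e _

theorem realizes_mc {S : List β} {t : β} (M : unitaryGroup Bool ℂ) (hS : S.Nodup) (ht : t ∉ S) :
    Realizes D (OracleCircuit.ofGates (mc S t M))
      (ucU t fun s => if ∀ w ∈ S, s w = false then M else 1) := by
  rw [Realizes, OracleCircuit.run_ofGates]
  exact mc_impl S t M hS ht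

/-- The circuit for `ampStep`. -/
def ampProg (S : List β) (t h : β) (B : OracleCircuit V (β ⊕ Option β)) (q : Bool × Circle) :
    OracleCircuit V (β ⊕ Option β) :=
  B ++ [.gate (cGate (.inr none) (.inl h) fun _ => ph q.1 q.2)] ++ B.inv ++
    OracleCircuit.ofGates (mc S t (ph false q.2)) ++ B

theorem realizes_ampProg {S : List β} {t : β} (hS : S.Nodup) (ht : t ∉ S) (h : β)
    (hB : Realizes D B T) (q : Bool × Circle) :
    Realizes D (ampProg S t h B q) (ampStep S t h T q) :=
  (((hB.append (realizes_cGate_const h _)).append hB.inv).append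
    (realizes_mc _ hS ht)).append hB

theorem realizes_foldl {S : List β} {t : β} (hS : S.Nodup) (ht : t ∉ S) (h : β)
    (hB : Realizes D B T) (l : List (Bool × Circle)) :
    Realizes D (l.foldl (ampProg S t h) B) (l.foldl (ampStep S t h) T) := by
  induction l generalizing B T with
  | nil => exact hB
  | cons q l ih => exact ih (realizes_ampProg hS ht h hB q)

omit [Fintype V] [DecidableEq V] [Fintype β] in
theorem weight_foldl (a b : ℕ) (S : List β) (t h : β) (B : OracleCircuit V (β ⊕ Option β))
    (l : List (Bool × Circle)) :
    OracleCircuit.weight a b (l.foldl (ampProg S t h) B) ≤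
      3 ^ l.length * (OracleCircuit.weight a b B + a * (8 * S.length + 4)) := by
  -- A step with overhead K turns the weight w into 3w + K. Carrying K along makes the induction
  -- multiplicative: 3w + 2K ≤ 3(w + K).
  have key : OracleCircuit.weight a b (l.foldl (ampProg S t h) B) + a * (8 * S.length + 4) ≤
      3 ^ l.length * (OracleCircuit.weight a b B + a * (8 * S.length + 4)) := by
    induction l generalizing B with
    | nil => simp
    | cons q l ih =>
      refine (ih _).trans ?_
      rw [List.length_cons, pow_succ, mul_assoc]
      refine Nat.mul_le_mul_left _ ?_
      have hg : OracleCircuit.weight a b ([.gate (cGate (.inr none) (.inl h) fun _ => ph q.1 q.2)] :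
        OracleCircuit V (β ⊕ Option β)) = a := by simp [OracleCircuit.weight]
      simp only [ampProg, OracleCircuit.weight_append, OracleCircuit.weight_inv,
        OracleCircuit.weight_ofGates, mc_length, hg]
      nlinarith
  omega

open Classical in
/-- The qubits outside `Φ` that are different from `t`. -/
def offList (Φ : Set β) (t : β) : List β :=
  (Finset.univ.filter fun w => w ∉ Φ ∧ w ≠ t).toList

theorem mem_offList {Φ : Set β} {t w : β} : w ∈ offList Φ t ↔ w ∉ Φ ∧ w ≠ t := by
  simp [offList]

theorem nodup_offList (Φ : Set β) (t : β) : (offList Φ t).Nodup := Finset.nodup_toList _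

theorem not_mem_offList (Φ : Set β) (t : β) : t ∉ offList Φ t := by
  simp [mem_offList]

theorem mem_cons_offList {Φ : Set β} {t : β} (ht : t ∉ Φ) (w : β) :
    w ∈ t :: offList Φ t ↔ w ∉ Φ := by
  rw [List.mem_cons, mem_offList]
  by_cases h : w = t
  · simp [h, ht]
  · simp [h]

theorem length_offList_le (Φ : Set β) (t : β) : (offList Φ t).length ≤ Fintype.card β := by
  rw [offList, Finset.length_toList]
  exact Finset.card_le_univ _

theorem fixing_anti {Φ Ψ : Set β} (h : Φ ⊆ Ψ) (hT : T ∈ fixing Ψ) : T ∈ fixing Φ :=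
  fun s s' hs w hw => hT s s' hs w (h hw)

end Programs

/-! ### The registers -/

section Registers

variable {n x : ℕ}

/-- An index register, the output flag, the qubits of the oracle, and one more flag. -/
abbrev Reg (n x : ℕ) := Fin n ⊕ Unit ⊕ (Wire n x ⊕ Unit)

/-- The qubits of the index register. -/
abbrev idxW (i : Fin n) : Reg n x := .inl i

/-- The output flag. -/
abbrev outW : Reg n x := .inr (.inl ())

/-- The qubits on which the oracle acts. -/
def workW : Wire n x ↪ Reg n x :=
  Function.Embedding.inl.trans (Function.Embedding.inr.trans Function.Embedding.inr)

/-- The flag of the oracle. -/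
abbrev oracleW : Reg n x := workW (.inr (.inl ()))

/-- A flag that records the complement of the flag of the oracle. -/
abbrev auxW : Reg n x := .inr (.inr (.inr ()))

theorem workW_apply (v : Wire n x) : workW v = (.inr (.inr (.inl v)) : Reg n x) := rfl

/-- The basis state with the index `j`, the output flag `b`, and all other qubits `0`. -/
def st (j : Fin (2 ^ n)) (b : Bool) : Reg n x → Bool :=
  Sum.elim (fun i => (j : ℕ).testBit i) (Sum.elim (fun _ => b) fun _ => false)

/-- The qubits on which the oracle does not act. -/
def offWork (n x : ℕ) : Set (Reg n x) := (Set.range workW)ᶜ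

theorem workW_not_mem (v : Wire n x) : workW v ∉ offWork n x := by simp [offWork]

theorem idxW_mem (i : Fin n) : (idxW i : Reg n x) ∈ offWork n x := by
  simp [offWork, workW_apply]

theorem outW_mem : (outW : Reg n x) ∈ offWork n x := by simp [offWork, workW_apply]

theorem auxW_mem : (auxW : Reg n x) ∈ offWork n x := by simp [offWork, workW_apply]

theorem st_off (j : Fin (2 ^ n)) (b : Bool) {w : Reg n x} (hw : w ∉ offWork n x) :
    st j b w = false := by
  obtain ⟨v, rfl⟩ : w ∈ Set.range workW := by
    by_contra h
    exact hw h
  rfl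

/-- The gate that copies one bit of the index to the register of the oracle. -/
def copyGate (i : Fin n) : Instr (Wire n x) (Reg n x ⊕ Option (Reg n x)) :=
  .gate (cGate (.inl (idxW i)) (.inl (workW (.inl i))) fun b => if b then flip else 1)

/-- The effect of copying the bits in the list `l` of the index. -/
def copyState (l : List (Fin n)) (σ : Reg n x → Bool) : Reg n x → Bool :=
  l.foldl (fun τ i => Function.update τ (workW (.inl i)) (τ (idxW i))) σ

theorem copyState_off (l : List (Fin n)) (σ : Reg n x → Bool) {w : Reg n x}
    (hw : ∀ i, w ≠ workW (.inl i)) : copyState l σ w = σ w := by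
  induction l generalizing σ with
  | nil => rfl
  | cons i l ih => exact (ih _).trans (Function.update_of_ne (hw i) _ _)

theorem copyState_workW (l : List (Fin n)) (σ : Reg n x → Bool) (i : Fin n) :
    copyState l σ (workW (.inl i)) = if i ∈ l then σ (idxW i) else σ (workW (.inl i)) := by
  induction l generalizing σ with
  | nil => rfl
  | cons k l ih =>
    have h1 : Function.update σ (workW (.inl k)) (σ (idxW k)) (idxW i) = σ (idxW i) :=
      Function.update_of_ne (by simp [workW_apply]) _ _
    refine (ih (Function.update σ (workW (.inl k)) (σ (idxW k)))).trans ?_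
    rw [h1]
    by_cases hk : i = k
    · subst hk
      simp
    · simp [hk]

theorem exists_copy (D : Circuit (Wire n x)) (l : List (Fin n)) (hl : l.Nodup) :
    ∃ T : unitaryGroup (Reg n x → Bool) ℂ, Realizes D (l.map copyGate) T ∧
      T ∈ fixing (offWork n x) ∧ ∀ σ, (∀ i ∈ l, σ (workW (.inl i)) = false) → ∀ s,
        (T : Matrix (Reg n x → Bool) (Reg n x → Bool) ℂ) s σ =
          if s = copyState l σ then 1 else 0 := by
  induction l with
  | nil => exact ⟨1, realizes_nil, one_mem _, fun σ _ s => Matrix.one_apply⟩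
  | cons i l ih =>
    obtain ⟨T, h1, h2, h3⟩ := ih hl.of_cons
    refine ⟨T * _, (realizes_cGate (c := idxW i) (t := workW (.inl i))
      (by simp [workW_apply]) _).append h1, mul_mem h2 (ucU_mem_fixing (workW_not_mem _) _), ?_⟩
    intro σ hσ s
    have hT := h3 (Function.update σ (workW (.inl i)) (σ (idxW i))) (by
      intro k hk
      rw [Function.update_of_ne, hσ k (by simp [hk])]
      have : k ≠ i := by
        rintro rfl
        exact (List.nodup_cons.1 hl).1 hk
      simpa using this) s
    have hU : ∀ r, uc (workW (.inl i))
        (fun s : Reg n x → Bool => if s (idxW i) then flip else 1) r σ = if r = Function.update σ (workW (.inl i)) (σ (idxW i)) then 1 else 0 := by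
      intro r
      have hi : σ (workW (.inl i)) = false := hσ i (by simp)
      have hne : (idxW i : Reg n x) ≠ workW (.inl i) := by simp [workW_apply]
      have he : r = Function.update σ (workW (.inl i)) (σ (idxW i)) ↔
          (∀ w, w ≠ workW (.inl i) → r w = σ w) ∧ r (workW (.inl i)) = σ (idxW i) := by
        rw [Function.eq_update_iff]
        exact and_comm
      rw [uc_apply, hi, Function.update_of_ne hne]
      by_cases hr : ∀ w, w ≠ workW (.inl i) → r w = σ w
      · rw [if_pos hr, hr _ hne]
        have he' : r = Function.update σ (workW (.inl i)) (σ (idxW i)) ↔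
            r (workW (.inl i)) = σ (idxW i) := he.trans (and_iff_right hr)
        simp only [he']
        cases σ (idxW i) <;> cases r (workW (.inl i)) <;> simp [flip_apply]
      · rw [if_neg hr, if_neg fun h => hr (he.1 h).1]
    rw [UnitaryGroup.mul_val, Matrix.mul_apply]
    simp only [ucU, hU, mul_ite, mul_one, mul_zero, Finset.sum_ite_eq', Finset.mem_univ, if_true]
    exact hT

/-- The oracle, applied to a copy of the index. -/
def baseProg (n x : ℕ) : OracleCircuit (Wire n x) (Reg n x ⊕ Option (Reg n x)) :=
  (List.finRange n).map copyGate ++ [.query (workW.trans Function.Embedding.inl)]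

theorem weight_baseProg (a b : ℕ) : OracleCircuit.weight a b (baseProg n x) = n * a + b := by
  have h : ∀ l : List (Fin n), OracleCircuit.weight a b (l.map (copyGate (x := x))) =
      l.length * a := by
    intro l
    simp [OracleCircuit.weight, Function.comp_def, copyGate]
  rw [baseProg, OracleCircuit.weight_append, h]
  simp [OracleCircuit.weight]

/-- The oracle may damage its copy of the index but never the original, whence the membership in
`fixing`. The amplitude of one basis state is a single term of the probability, so it yields a lower
bound only. -/
theorem exists_base (D : Circuit (Wire n x)) :
    ∃ T : unitaryGroup (Reg n x → Bool) ℂ, Realizes D (baseProg n x) T ∧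
      T ∈ fixing (offWork n x) ∧ ∀ (j : Fin (2 ^ n)) (b : Bool),
        ‖amp D j b zeros j false zeros‖ ^ 2 ≤ prob T oracleW b (st j false) := by
  classical
  obtain ⟨T, h1, h2, h3⟩ := exists_copy D (List.finRange n) (List.nodup_finRange n)
  refine ⟨_, h1.append (realizes_query workW),
    mul_mem (opOnU_mem_fixing workW workW_not_mem _) h2, fun j b => ?_⟩
  set s : Reg n x → Bool := Sum.elim (fun i => (j : ℕ).testBit i)
    (Sum.elim (fun _ => false) (Sum.elim (ket j b zeros) fun _ => false)) with hs
  have hmem : s ∈ Finset.univ.filter fun s : Reg n x → Bool => s oracleW = b := by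
    simp only [Finset.mem_filter, Finset.mem_univ, true_and]
    rfl
  refine le_trans (le_of_eq ?_) (Finset.single_le_sum (fun _ _ => by positivity) hmem)
  congr 2
  rw [UnitaryGroup.mul_val, Matrix.mul_apply]
  simp only [h3 (st j false) (fun i _ => rfl), mul_ite, mul_one, mul_zero, Finset.sum_ite_eq',
    Finset.mem_univ, if_true]
  change _ = opOn workW D.eval _ _
  have hc : copyState (List.finRange n) (st j false) ∘ workW = ket (a := x) j false zeros := by
    funext v
    rcases v with i | u | k
    · exact (copyState_workW _ _ i).trans (by simp [st, ket])
    · exact copyState_off _ _ (by simp)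
    · exact copyState_off _ _ (by simp)
  rw [opOn_apply, if_pos, hc]
  · rfl
  · intro w hw
    rw [copyState_off _ _ fun i h => hw ⟨_, h.symm⟩]
    rcases w with i | u | v | u
    · rfl
    · rfl
    · exact absurd ⟨v, rfl⟩ hw
    · rfl

/-- Prepares the uniform superposition of the indices with bits in `l`. -/
def unifProg : List (Fin n) → OracleCircuit (Wire n x) (Reg n x ⊕ Option (Reg n x))
  | [] => []
  | i :: l => unifProg l ++ [.gate (cGate (.inr none) (.inl (idxW i)) fun _ => rot)]

theorem weight_unifProg (a b : ℕ) (l : List (Fin n)) :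
    OracleCircuit.weight a b (unifProg (x := x) l) = l.length * a := by
  induction l with
  | nil => simp [unifProg, OracleCircuit.weight]
  | cons i l ih =>
    rw [unifProg, OracleCircuit.weight_append, ih]
    simp [OracleCircuit.weight]
    ring

open Classical in
theorem exists_unif (D : Circuit (Wire n x)) (l : List (Fin n)) (hl : l.Nodup) :
    ∃ T : unitaryGroup (Reg n x → Bool) ℂ, Realizes D (unifProg l) T ∧
      ∀ s, (T : Matrix (Reg n x → Bool) (Reg n x → Bool) ℂ) s (fun _ => false) =
        if ∀ w, w ∉ l.map idxW → s w = false then (((√2)⁻¹ : ℝ) : ℂ) ^ l.length else 0 := by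
  induction l with
  | nil =>
    refine ⟨1, realizes_nil, fun s => ?_⟩
    by_cases h : ∀ w, s w = false
    · obtain rfl : s = fun _ => false := funext h
      simp
    · rw [if_neg (by simpa only [List.map_nil, List.not_mem_nil, not_false_eq_true,
        true_imp_iff] using h)]
      exact Matrix.one_apply_ne fun hs => h fun w => congrFun hs w
  | cons i l ih =>
    obtain ⟨T, h1, h2⟩ := ih hl.of_cons
    refine ⟨_, h1.append (realizes_cGate_const (idxW i) rot), fun s => ?_⟩
    have hi : (idxW i : Reg n x) ∉ l.map (idxW (x := x)) := by
      simpa using (List.nodup_cons.1 hl).1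
    refine (uc_mul_apply _ _ _ s _).trans ?_
    rw [Fintype.sum_bool, h2, h2, if_neg, mul_zero, zero_add]
    · have : (∀ w, w ∉ l.map (idxW (x := x)) → Function.update s (idxW i) false w = false) ↔
          ∀ w, w ∉ (i :: l).map (idxW (x := x)) → s w = false := by
        refine forall_congr' fun w => ?_
        by_cases hw : w = idxW i
        · subst hw; simp
        · rw [Function.update_of_ne hw, List.map_cons, List.mem_cons]
          simp [hw]
      simp only [this]
      split_ifs
      · simp [rot_apply, pow_succ']
      · simp
    · intro h
      simpa using h _ hi

end Registers

/-! ### Turning the probability of the oracle flag into a clean amplitude -/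

section Search

variable {n x : ℕ}

theorem st_injective (b : Bool) :
    Function.Injective fun j : Fin (2 ^ n) => (st j b : Reg n x → Bool) := by
  intro j k h
  refine Fin.ext (Nat.eq_of_testBit_eq fun i => ?_)
  by_cases hi : i < n
  · exact congrFun h (.inl ⟨i, hi⟩)
  · have : ∀ l : Fin (2 ^ n), (l : ℕ).testBit i = false := fun l =>
      Nat.testBit_lt_two_pow (l.2.trans_le (Nat.pow_le_pow_right (by norm_num) (by omega)))
    rw [this, this]

/-- The index register and the output flag. -/
def outSet (n x : ℕ) : Set (Reg n x) := {w | w = outW ∨ ∃ i, w = idxW i}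

theorem outSet_subset : outSet n x ⊆ offWork n x := by
  rintro w (rfl | ⟨i, rfl⟩)
  · exact outW_mem
  · exact idxW_mem i

theorem auxW_not_mem : (auxW : Reg n x) ∉ outSet n x := by simp [outSet]

theorem exists_eq_st (s : Reg n x → Bool) (hs : ∀ w, w ∉ outSet n x → s w = false) :
    ∃ j : Fin (2 ^ n), s = st j (s outW) := by
  refine ⟨⟨Nat.ofBits fun i => s (idxW i), Nat.ofBits_lt_two_pow _⟩, funext fun w => ?_⟩
  by_cases hw : w ∈ outSet n x
  · obtain rfl | ⟨i, rfl⟩ := hw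
    · rfl
    · exact (Nat.testBit_ofBits_lt (fun i => s (idxW i)) _ i.2).symm
  · rw [hs w hw]
    rcases w with i | u | w
    · exact absurd (Or.inr ⟨i, rfl⟩) hw
    · exact absurd (Or.inl rfl) hw
    · rfl

/-- Prepares the uniform superposition of the indices and raises the output flag with an amplitude
proportional to the probability that `B` raises the flag of the oracle, restoring all other
qubits. -/
def flagProg (B : OracleCircuit (Wire n x) (Reg n x ⊕ Option (Reg n x))) :
    OracleCircuit (Wire n x) (Reg n x ⊕ Option (Reg n x)) :=
  unifProg (List.finRange n) ++ B ++
    [.gate (cGate (.inl oracleW) (.inl auxW) fun b => if b then 1 else flip)] ++ B.inv ++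
      OracleCircuit.ofGates (mc (offList (outSet n x) outW) outW flip)

theorem weight_flagProg (a b : ℕ) (B : OracleCircuit (Wire n x) (Reg n x ⊕ Option (Reg n x))) :
    OracleCircuit.weight a b (flagProg B) ≤
      2 * OracleCircuit.weight a b B + a * (n + 8 * Fintype.card (Reg n x) + 4) := by
  have h1 : OracleCircuit.weight a b
      ([.gate (cGate (.inl oracleW) (.inl auxW) fun b => if b then 1 else flip)] :
        OracleCircuit (Wire n x) (Reg n x ⊕ Option (Reg n x))) = a := by
    simp [OracleCircuit.weight]
  simp only [flagProg, OracleCircuit.weight_append, weight_unifProg, OracleCircuit.weight_inv, h1,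
    OracleCircuit.weight_ofGates, mc_length, List.length_finRange]
  have := Nat.mul_le_mul_left (8 * a) (length_offList_le (outSet n x) outW)
  nlinarith

/-- The unitary `V` never touches the auxiliary flag, so returning to the initial state selects the
branches in which that flag was not flipped. The entry is ⟨σ|V⁻¹ Π V|σ⟩ = ‖Π V|σ⟩‖², with Π the
projection onto oracle flag 1. -/
theorem conj_flip_apply {V : unitaryGroup (Reg n x → Bool) ℂ} (hV : V ∈ fixing (offWork n x))
    (j : Fin (2 ^ n)) :
    ((V⁻¹ * (ucU auxW (fun s => if s oracleW then 1 else flip) * V) :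
      unitaryGroup (Reg n x → Bool) ℂ) : Matrix (Reg n x → Bool) (Reg n x → Bool) ℂ)
        (st j false) (st j false) = prob V oracleW true (st j false) := by
  rw [UnitaryGroup.mul_val, Matrix.mul_apply, prob, Finset.sum_filter, Complex.ofReal_sum]
  refine Finset.sum_congr rfl fun s _ => ?_
  rw [UnitaryGroup.inv_val, Matrix.star_apply]
  by_cases h0 : (V : Matrix (Reg n x → Bool) (Reg n x → Bool) ℂ) s (st j false) = 0
  · simp [h0]
  · have hs : s auxW = false := eq_of_mem_fixing hV h0 auxW_mem
    have h1 : (V : Matrix (Reg n x → Bool) (Reg n x → Bool) ℂ)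
        (Function.update s auxW true) (st j false) = 0 := by
      by_contra h
      have := eq_of_mem_fixing hV h auxW_mem
      rw [Function.update_self] at this
      cases this
    have h2 : Function.update s auxW false = s := by rw [← hs, Function.update_eq_self]
    have h3 : ((ucU auxW (fun s => if s oracleW then 1 else flip) * V :
        unitaryGroup (Reg n x → Bool) ℂ) : Matrix (Reg n x → Bool) (Reg n x → Bool) ℂ)
          s (st j false) = if s oracleW = true then
            (V : Matrix (Reg n x → Bool) (Reg n x → Bool) ℂ) s (st j false) else 0 := by
      refine (uc_mul_apply auxW (fun s => if s oracleW then 1 else flip)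
        (V : Matrix (Reg n x → Bool) (Reg n x → Bool) ℂ) s (st j false)).trans ?_
      rw [Fintype.sum_bool, h1, h2, hs, mul_zero, zero_add]
      split_ifs with h
      · simp
      · simp [flip_apply]
    rw [h3]
    split_ifs
    · push_cast
      exact Complex.conj_mul' _
    · simp

/-- The output flag is raised only where all qubits other than the index and the flag are back at 0,
so garbage is never flagged. The conjugated flip preserves the index, so each index feeds only its
own flagged state. -/
theorem exists_flag {D : Circuit (Wire n x)}
    {B : OracleCircuit (Wire n x) (Reg n x ⊕ Option (Reg n x))}
    {V : unitaryGroup (Reg n x → Bool) ℂ} (hB : Realizes D B V) (hV : V ∈ fixing (offWork n x)) :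
    ∃ A : unitaryGroup (Reg n x → Bool) ℂ, Realizes D (flagProg B) A ∧
      (∀ j, (A : Matrix (Reg n x → Bool) (Reg n x → Bool) ℂ) (st j true) (fun _ => false) =
        (((√2)⁻¹ : ℝ) : ℂ) ^ n * prob V oracleW true (st j false)) ∧
      ∀ s, s outW = true →
        (A : Matrix (Reg n x → Bool) (Reg n x → Bool) ℂ) s (fun _ => false) ≠ 0 →
          ∃ j, s = st j true := by
  classical
  obtain ⟨H, hH, hH'⟩ := exists_unif D (List.finRange n) (List.nodup_finRange n)
  set Y : unitaryGroup (Reg n x → Bool) ℂ :=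
    V⁻¹ * (ucU auxW (fun s => if s oracleW then 1 else flip) * V) with hY
  have hVo := fixing_anti outSet_subset hV
  have hYΦ : Y ∈ fixing (outSet n x) :=
    mul_mem (inv_mem hVo) (mul_mem (ucU_mem_fixing auxW_not_mem _) hVo)
  have hN : Realizes D [.gate (cGate (.inl oracleW) (.inl auxW) fun b => if b then 1 else flip)]
      (ucU (auxW : Reg n x) fun s => if s oracleW then 1 else flip) :=
    realizes_cGate (by simp [workW_apply]) _
  have hM := realizes_mc (D := D) flip (nodup_offList (outSet n x) outW) (not_mem_offList _ _)
  have hout : (outW : Reg n x) ∈ outSet n x := Or.inl rfl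
  have hidx : ∀ w : Reg n x, w ∉ (List.finRange n).map (idxW (x := x)) ↔ ∀ i, w ≠ idxW i := by
    intro w
    simp [eq_comm]
  have hmem : ∀ w : Reg n x, w ∈ offList (outSet n x) outW ↔ w ∉ outSet n x := by
    intro w
    rw [mem_offList]
    exact and_iff_left_of_imp fun h h' => h (h' ▸ hout)
  have hYH : ∀ s : Reg n x → Bool, s outW = true → ((Y * H : unitaryGroup (Reg n x → Bool) ℂ) :
      Matrix (Reg n x → Bool) (Reg n x → Bool) ℂ) s (fun _ => false) = 0 := by
    intro s hs
    rw [UnitaryGroup.mul_val, Matrix.mul_apply]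
    refine Finset.sum_eq_zero fun r _ => ?_
    rw [hH']
    split_ifs with hr
    · have : (Y : Matrix (Reg n x → Bool) (Reg n x → Bool) ℂ) s r = 0 := by
        by_contra h0
        have h1 := eq_of_mem_fixing hYΦ h0 hout
        rw [hs, hr outW ((hidx _).2 (by simp))] at h1
        cases h1
      rw [this, zero_mul]
    · rw [mul_zero]
  have hA : ∀ s : Reg n x → Bool, s outW = true →
      ((ucU outW (fun s => if ∀ w ∈ offList (outSet n x) outW, s w = false then flip else 1) *
        (Y * H) : unitaryGroup (Reg n x → Bool) ℂ) :
          Matrix (Reg n x → Bool) (Reg n x → Bool) ℂ) s (fun _ => false) =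
        if ∀ w, w ∉ outSet n x → s w = false then
          ((Y * H : unitaryGroup (Reg n x → Bool) ℂ) :
            Matrix (Reg n x → Bool) (Reg n x → Bool) ℂ)
              (Function.update s outW false) (fun _ => false) else 0 := by
    intro s hs
    refine (uc_mul_apply outW
      (fun s => if ∀ w ∈ offList (outSet n x) outW, s w = false then flip else 1)
      ((Y * H : unitaryGroup (Reg n x → Bool) ℂ) :
        Matrix (Reg n x → Bool) (Reg n x → Bool) ℂ) s _).trans ?_
    have hc : (∀ w ∈ offList (outSet n x) outW, Function.update s outW false w = false) ↔
        ∀ w, w ∉ outSet n x → s w = false := by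
      refine forall_congr' fun w => ?_
      rw [hmem]
      refine imp_congr_right fun hw => ?_
      rw [Function.update_of_ne]
      rintro rfl
      exact hw hout
    rw [Fintype.sum_bool, hYH (Function.update s outW true) (by simp), mul_zero, zero_add, hs]
    by_cases h : ∀ w, w ∉ outSet n x → s w = false
    · rw [if_pos (hc.2 h), if_pos h]
      simp [flip_apply]
    · rw [if_neg fun h' => h (hc.1 h'), if_neg h]
      simp
  refine ⟨ucU outW (fun s => if ∀ w ∈ offList (outSet n x) outW, s w = false then flip else 1) *
        (Y * H), ?_, fun j => ?_, fun s hs h0 => ?_⟩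
  · have e : Y * H = V⁻¹ * (ucU auxW (fun s => if s oracleW then 1 else flip) * (V * H)) := by
      rw [hY, mul_assoc, mul_assoc]
    rw [e]
    rw [flagProg]
    convert (((hH.append hB).append hN).append hB.inv).append hM
  · rw [hA _ rfl, if_pos]
    · have hst : Function.update (st j true : Reg n x → Bool) outW false = st j false := by
        funext w
        rcases w with i | u | w
        · rfl
        · simp [st]
        · rfl
      rw [hst, UnitaryGroup.mul_val, Matrix.mul_apply, Finset.sum_eq_single (st j false)]
      · rw [hH', if_pos, List.length_finRange, hY, conj_flip_apply hV, mul_comm]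
        intro w hw
        rw [hidx] at hw
        rcases w with i | u | w
        · exact absurd rfl (hw i)
        · rfl
        · rfl
      · intro r _ hr
        rw [hH']
        split_ifs with hr0
        · have : (Y : Matrix (Reg n x → Bool) (Reg n x → Bool) ℂ) (st j false) r = 0 := by
            by_contra h0
            refine hr (funext fun w => ?_)
            by_cases hw : ∃ i, w = idxW i
            · exact (eq_of_mem_fixing hYΦ h0 (Or.inr hw)).symm
            · rw [hr0 w ((hidx w).2 fun i h => hw ⟨i, h⟩)]
              rcases w with i | u | w
              · exact absurd ⟨i, rfl⟩ hw
              · rfl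
              · rfl
          rw [this, zero_mul]
        · rw [mul_zero]
      · simp
    · intro w hw
      rcases w with i | u | w
      · exact absurd (Or.inr ⟨i, rfl⟩) hw
      · exact absurd (Or.inl rfl) hw
      · rfl
  · rw [hA s hs] at h0
    have h1 : ∀ w, w ∉ outSet n x → s w = false := by
      by_contra h
      exact h0 (if_neg h)
    obtain ⟨j, hj⟩ := exists_eq_st s h1
    exact ⟨j, by rw [hs] at hj; exact hj⟩

end Search

/-! ### Assembling the search circuit: correctness and cost -/

section Final

variable {n x : ℕ}

/-- The number of ancillary qubits of the search circuit. -/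
def ancCount (n x : ℕ) : ℕ := Fintype.card ((Wire n x ⊕ Unit) ⊕ Option (Reg n x))

/-- All qubits other than the index and the output flag become ancillary qubits. -/
def layout (n x : ℕ) : Reg n x ⊕ Option (Reg n x) ≃ Wire n (ancCount n x) :=
  (Equiv.sumAssoc _ _ _).trans ((Equiv.refl _).sumCongr
    ((Equiv.sumAssoc _ _ _).trans ((Equiv.refl _).sumCongr (Fintype.equivFin _))))

theorem ket_comp_layout_inl (j : Fin (2 ^ n)) (b : Bool) :
    (ket j b zeros ∘ layout n x) ∘ Sum.inl = st j b := by
  funext w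
  rcases w with i | u | w <;> rfl

theorem ket_comp_layout_inr (j : Fin (2 ^ n)) (b : Bool) (o : Option (Reg n x)) :
    (ket j b zeros ∘ layout n x) (.inr o) = false := rfl

theorem ket_zero {a : ℕ} : ket (n := n) (a := a) 0 false zeros = fun _ => false := by
  funext w
  rcases w with i | u | k
  · exact Nat.zero_testBit i
  · rfl
  · rfl

theorem eq_zeros_of_comp_layout {j j' : Fin (2 ^ n)} {b b' : Bool} {z : Fin (ancCount n x) → Bool}
    (h1 : (ket j b z ∘ layout n x) ∘ Sum.inl = st j' b')
    (h2 : ∀ o, (ket j b z ∘ layout n x) (.inr o) = false) : z = zeros := by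
  funext k
  have hz : z k = (ket j b z ∘ layout n x) ((layout n x).symm (.inr (.inr k))) := by
    simp [ket]
  rw [hz]
  have hk : layout n x ((layout n x).symm (.inr (.inr k))) = .inr (.inr k) := by simp
  rcases h : (layout n x).symm (.inr (.inr k)) with (i | u | w) | o
  · rw [h] at hk
    cases hk
  · rw [h] at hk
    cases hk
  · exact congrFun h1 (.inr (.inr w))
  · exact h2 o

theorem amp_relabel {D : Circuit (Wire n x)}
    {B : OracleCircuit (Wire n x) (Reg n x ⊕ Option (Reg n x))}
    {T : unitaryGroup (Reg n x → Bool) ℂ} (hB : Realizes D B T) (j : Fin (2 ^ n)) (b : Bool)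
    (z : Fin (ancCount n x) → Bool) :
    amp ((OracleCircuit.relabel (layout n x).toEmbedding B).run D) j b z 0 false zeros =
      emb (fun s => (T : Matrix (Reg n x → Bool) (Reg n x → Bool) ℂ) s fun _ => false)
        (ket j b z ∘ layout n x) := by
  have h1 := hB (Pi.single (fun _ => false) 1)
  have h2 : emb (Pi.single (fun _ => false : Reg n x → Bool) (1 : ℂ)) =
      Pi.single (fun _ => false) 1 := by
    funext s
    by_cases hs : s = fun _ => false
    · subst hs
      simp only [emb, implies_true, if_true, Pi.single_eq_same]
      exact Pi.single_eq_same _ _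
    · rw [Pi.single_eq_of_ne hs, emb]
      split_ifs with h
      · refine Pi.single_eq_of_ne (fun h' => hs ?_) _
        funext w
        rcases w with w | o
        · exact congrFun h' w
        · exact h o
      · rfl
  rw [h2, mulVec_single_one, mulVec_single_one] at h1
  rw [amp, OracleCircuit.run_relabel, Circuit.eval_relabel, opOn_equiv, ket_zero]
  exact congrFun h1 _

theorem sum_norm_sq_eq_prob (T : unitaryGroup (Reg n x → Bool) ℂ) (σ : Reg n x → Bool)
    (hT : ∀ s, s outW = true → (T : Matrix (Reg n x → Bool) (Reg n x → Bool) ℂ) s σ ≠ 0 →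
      ∃ j, s = st j true) :
    ∑ j, ‖(T : Matrix (Reg n x → Bool) (Reg n x → Bool) ℂ) (st j true) σ‖ ^ 2 =
      prob T outW true σ := by
  rw [prob]
  refine Finset.sum_of_injOn (fun j => st j true) (st_injective true).injOn ?_ ?_ ?_
  · intro j _
    simp only [Finset.coe_filter, Finset.mem_univ, true_and, Set.mem_ofPred_eq]
    rfl
  · intro s hs hs'
    simp only [Finset.mem_filter, Finset.mem_univ, true_and] at hs
    have : (T : Matrix (Reg n x → Bool) (Reg n x → Bool) ℂ) s σ = 0 := by
      by_contra h
      obtain ⟨j, rfl⟩ := hT s hs h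
      exact hs' ⟨j, by simp, rfl⟩
    simp [this]
  · intro j _
    rfl

/-- The oracle with an amplified gap. -/
def gapProg (n x r : ℕ) : OracleCircuit (Wire n x) (Reg n x ⊕ Option (Reg n x)) :=
  (gapList (r + 1)).foldl (ampProg (offList (offWork n x) oracleW) oracleW oracleW) (baseProg n x)

/-- Fixed-point search. -/
def searchProg (n x r m : ℕ) : OracleCircuit (Wire n x) (Reg n x ⊕ Option (Reg n x)) :=
  (chebList (3 / 3 ^ m) m).foldl (ampProg (offList ∅ outW) outW outW) (flagProg (gapProg n x r))

theorem exists_gap (D : Circuit (Wire n x)) (r : ℕ) :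
    ∃ V : unitaryGroup (Reg n x → Bool) ℂ, Realizes D (gapProg n x r) V ∧
      V ∈ fixing (offWork n x) ∧ ∀ j : Fin (2 ^ n),
        (2 / 3 ≤ ‖amp D j false zeros j false zeros‖ ^ 2 →
          2 * prob V oracleW true (st j false) ≤ (1 / 4) ^ 3 ^ r) ∧
        (2 / 3 ≤ ‖amp D j true zeros j false zeros‖ ^ 2 →
          22 / 25 ≤ prob V oracleW true (st j false)) := by
  obtain ⟨T, h1, h2, h3⟩ := exists_base D
  have ht : (oracleW : Reg n x) ∉ offWork n x := workW_not_mem _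
  have hZ := mem_cons_offList ht
  have hS := not_mem_offList (offWork n x) oracleW
  have hσ : ∀ j, ∀ w : Reg n x, w ∉ offWork n x → st j false w = false :=
    fun j w hw => st_off j false hw
  refine ⟨_, realizes_foldl (nodup_offList _ _) hS _ h1 _, foldl_ampStep_mem_fixing hZ ht h2 _,
    fun j => ⟨fun h => prob_gap_small hZ hS ht h2 (hσ j) ?_ r,
      fun h => prob_gap_large hZ hS ht h2 (hσ j) (h.trans (h3 j true)) _⟩⟩
  have := prob_add T oracleW true (st j false)
  have := h3 j false
  simp only [Bool.not_true] at *
  linarith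

/-- Here `z` is the squared modulus of the scalar in `chebList_eq_mul`, and `P j` is the amplified
flag probability. The parameter 3/3^m is chosen so that m triplings end at 3. -/
theorem exists_search (D : Circuit (Wire n x)) (r m : ℕ) :
    ∃ (T : unitaryGroup (Reg n x → Bool) ℂ) (P : Fin (2 ^ n) → ℝ) (z : ℝ),
      Realizes D (searchProg n x r m) T ∧ 0 ≤ z ∧ z ≤ (3 ^ m) ^ 2 ∧
      (∀ s, s outW = true →
        (T : Matrix (Reg n x → Bool) (Reg n x → Bool) ℂ) s (fun _ => false) ≠ 0 →
          ∃ j, s = st j true) ∧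
      (∀ j, ‖(T : Matrix (Reg n x → Bool) (Reg n x → Bool) ℂ) (st j true) fun _ => false‖ ^ 2 =
        z * ((1 / 2) ^ n * P j ^ 2)) ∧
      (∀ j, 0 ≤ P j ∧ (2 / 3 ≤ ‖amp D j false zeros j false zeros‖ ^ 2 →
          2 * P j ≤ (1 / 4) ^ 3 ^ r) ∧
        (2 / 3 ≤ ‖amp D j true zeros j false zeros‖ ^ 2 → 22 / 25 ≤ P j)) ∧
      (Real.cosh (3 / 3 ^ m) ^ 2 * (1 - ∑ j, (1 / 2) ^ n * P j ^ 2) ≤ 1 →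
        Real.cosh 3 ^ 2 * (1 - ∑ j,
          ‖(T : Matrix (Reg n x → Bool) (Reg n x → Bool) ℂ) (st j true) fun _ => false‖ ^ 2) ≤ 1) := by
  obtain ⟨V, h1, h2, h3⟩ := exists_gap D r
  obtain ⟨A, h4, h5, h6⟩ := exists_flag h1 h2
  have ht : (outW : Reg n x) ∉ (∅ : Set (Reg n x)) := by simp
  have hZ := mem_cons_offList ht
  have hS := not_mem_offList (∅ : Set (Reg n x)) outW
  have hA : A ∈ fixing (∅ : Set (Reg n x)) := fun s s' _ w hw => absurd hw (by simp)
  obtain ⟨z, hz, hz'⟩ := chebList_eq_mul hZ hS ht hA (σ := fun _ => false) (fun _ _ => rfl)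
    (3 / 3 ^ m) m
  have hc : ∀ j, ‖(A : Matrix (Reg n x → Bool) (Reg n x → Bool) ℂ) (st j true) fun _ => false‖ ^ 2
      = (1 / 2) ^ n * prob V oracleW true (st j false) ^ 2 := by
    intro j
    rw [h5, norm_mul, norm_pow, Complex.norm_real, Complex.norm_real, mul_pow, Real.norm_eq_abs,
      Real.norm_eq_abs, sq_abs, ← pow_mul, mul_comm n 2, pow_mul, sq_abs, inv_pow,
      Real.sq_sqrt (by norm_num), one_div]
  have hsupp : ∀ s, s outW = true →
      (((chebList (3 / 3 ^ m) m).foldl (ampStep (offList ∅ outW) outW outW) A :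
        unitaryGroup (Reg n x → Bool) ℂ) : Matrix (Reg n x → Bool) (Reg n x → Bool) ℂ) s
          (fun _ => false) ≠ 0 → ∃ j, s = st j true := by
    intro s hs h0
    refine h6 s hs fun h => h0 ?_
    rw [hz' s hs, h, mul_zero]
  refine ⟨_, fun j => prob V oracleW true (st j false), ‖z‖ ^ 2,
    realizes_foldl (nodup_offList _ _) hS _ h4 _, by positivity, ?_, hsupp, fun j => ?_,
    fun j => ⟨prob_nonneg _ _ _ _, h3 j⟩, fun h => ?_⟩
  · exact pow_le_pow_left₀ (norm_nonneg z) hz 2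
  · rw [hz' _ rfl, norm_mul, mul_pow, hc]
  · have h7 := chebList_prob hZ hS ht hA (σ := fun _ => false) (fun _ _ => rfl) (3 / 3 ^ m) (by
      have h8 := prob_add A outW true fun _ => false
      rw [← sum_norm_sq_eq_prob A _ h6, Finset.sum_congr rfl fun j _ => hc j] at h8
      rw [← eq_sub_iff_add_eq'] at h8
      exact (congrArg _ h8).trans_le h) m
    have h8 := prob_add ((chebList (3 / 3 ^ m) m).foldl (ampStep (offList ∅ outW) outW outW) A)
      outW true fun _ => false
    rw [← sum_norm_sq_eq_prob _ _ hsupp, ← eq_sub_iff_add_eq'] at h8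
    rw [← h8]
    have h9 : (3 : ℝ) ^ m * (3 / 3 ^ m) = 3 := by field_simp
    rwa [h9] at h7

theorem four_le_cosh_three : 4 ≤ Real.cosh 3 := by
  have h1 : (3 : ℝ) + 1 ≤ Real.exp 3 := Real.add_one_le_exp 3
  have h2 : Real.exp 3 = Real.exp 1 ^ 3 := by
    rw [← Real.exp_nat_mul]; norm_num
  have h3 := Real.exp_one_gt_d9
  have h4 : (2 : ℝ) ^ 3 ≤ Real.exp 1 ^ 3 := pow_le_pow_left₀ (by norm_num) (by linarith) 3
  rw [Real.cosh_eq]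
  have h5 := Real.exp_pos (-3)
  norm_num at h4
  linarith

theorem search_correct {r m : ℕ} (hr : n + 2 ≤ 3 ^ r) (hm : 16 * 2 ^ n ≤ ((3 : ℝ) ^ m) ^ 2)
    (hm' : ((3 : ℝ) ^ m) ^ 2 ≤ 144 * 2 ^ n) (F : Fin (2 ^ n) → Fin 3) (D : Circuit (Wire n x))
    (h0 : ∀ j, F j = 0 → 2 / 3 ≤ ‖amp D j false zeros j false zeros‖ ^ 2)
    (h1 : ∀ j, F j = 1 → 2 / 3 ≤ ‖amp D j true zeros j false zeros‖ ^ 2) :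
    ((∃ j, F j = 1) → 2 / 3 ≤ ∑ j : Fin (2 ^ n) with F j = 1 ∨ F j = 2,
      ‖amp ((OracleCircuit.relabel (layout n x).toEmbedding (searchProg n x r m)).run D) j true
        zeros 0 false zeros‖ ^ 2) ∧
    ∑ j : Fin (2 ^ n) with F j = 0, ∑ z : Fin (ancCount n x) → Bool,
      ‖amp ((OracleCircuit.relabel (layout n x).toEmbedding (searchProg n x r m)).run D) j true
        z 0 false zeros‖ ^ 2 ≤ 1 / 3 := by
  obtain ⟨T, P, z, hT, hz0, hz, hsupp, hg, hP, hcheb⟩ := exists_search D r m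
  have hamp : ∀ j, amp ((OracleCircuit.relabel (layout n x).toEmbedding
      (searchProg n x r m)).run D) j true zeros 0 false zeros =
        (T : Matrix (Reg n x → Bool) (Reg n x → Bool) ℂ) (st j true) fun _ => false := by
    intro j
    rw [amp_relabel hT, emb, if_pos (ket_comp_layout_inr j true), ket_comp_layout_inl]
  have hamp0 : ∀ j, ∀ y, y ≠ zeros → amp ((OracleCircuit.relabel (layout n x).toEmbedding
      (searchProg n x r m)).run D) j true y 0 false zeros = 0 := by
    intro j y hy
    by_contra h
    rw [amp_relabel hT, emb] at h
    split_ifs at h with h2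
    · obtain ⟨j', hj'⟩ := hsupp _ rfl h
      exact hy (eq_zeros_of_comp_layout hj' h2)
    · exact h rfl
  have hsum : ∀ j, ∑ y : Fin (ancCount n x) → Bool, ‖amp ((OracleCircuit.relabel
      (layout n x).toEmbedding (searchProg n x r m)).run D) j true y 0 false zeros‖ ^ 2 =
        z * ((1 / 2) ^ n * P j ^ 2) := by
    intro j
    rw [Finset.sum_eq_single zeros, hamp, hg]
    · intro y _ hy
      simp [hamp0 j y hy]
    · simp
  have hN : ((1 : ℝ) / 2) ^ n * 2 ^ n = 1 := by
    rw [← mul_pow]; norm_num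
  -- From `z ≤ 144 * 2 ^ n` and `P j ^ 2 ≤ 16⁻ⁿ / 1024` one gets `z * P j ^ 2 ≤ 144 / 1024 < 1 / 7`;
  -- averaging over the N indices keeps this bound.
  have hsmall : ∑ j : Fin (2 ^ n) with F j = 0, z * ((1 / 2) ^ n * P j ^ 2) ≤ 1 / 7 := by
    have hδ : ∀ j, F j = 0 → P j ^ 2 ≤ (1 / 4) * ((1 / 16) * (1 / 16) * (1 / 16) ^ n) := by
      intro j hj
      have h2 := (hP j).2.1 (h0 j hj)
      have h3 : ((1 : ℝ) / 4) ^ 3 ^ r ≤ (1 / 4) ^ (n + 2) :=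
        pow_le_pow_of_le_one (by norm_num) (by norm_num) hr
      have h4 := pow_le_pow_left₀ (by linarith [(hP j).1]) (h2.trans h3) 2
      have h5 : (((1 : ℝ) / 4) ^ (n + 2)) ^ 2 = (1 / 16) * (1 / 16) * (1 / 16) ^ n := by
        rw [← pow_mul, mul_comm, pow_mul, pow_add]
        norm_num
        ring
      rw [h5] at h4
      linarith
    have hterm : ∀ j, F j = 0 → z * ((1 / 2) ^ n * P j ^ 2) ≤ (1 / 7) * (1 / 2) ^ n := by
      intro j hj
      have h2 : z ≤ 144 * 2 ^ n := hz.trans hm'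
      have h3 : ((2 : ℝ) ^ n) * (1 / 16) ^ n ≤ 1 := by
        rw [← mul_pow]
        exact pow_le_one₀ (by norm_num) (by norm_num)
      have h4 : z * P j ^ 2 ≤ 144 * 2 ^ n * ((1 / 4) * ((1 / 16) * (1 / 16) * (1 / 16) ^ n)) :=
        mul_le_mul h2 (hδ j hj) (by positivity) (by positivity)
      have h5 : z * P j ^ 2 ≤ 1 / 7 * 1 := by nlinarith
      have h6 : (0 : ℝ) < (1 / 2) ^ n := by positivity
      nlinarith
    calc ∑ j : Fin (2 ^ n) with F j = 0, z * ((1 / 2) ^ n * P j ^ 2)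
        ≤ ∑ j : Fin (2 ^ n) with F j = 0, (1 / 7) * ((1 : ℝ) / 2) ^ n :=
          Finset.sum_le_sum fun j hj => hterm j (by simpa using hj)
      _ ≤ ∑ j : Fin (2 ^ n), (1 / 7) * ((1 : ℝ) / 2) ^ n :=
          Finset.sum_le_sum_of_subset_of_nonneg (Finset.filter_subset _ _)
            fun _ _ _ => by positivity
      _ = 1 / 7 := by
          rw [Finset.sum_const, Finset.card_univ, Fintype.card_fin, nsmul_eq_mul]
          push_cast
          linear_combination (1 / 7) * hN
  refine ⟨?_, ?_⟩
  · rintro ⟨j₁, hj₁⟩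
    have hu : Real.cosh (3 / 3 ^ m) ^ 2 * (1 - ∑ j, (1 / 2) ^ n * P j ^ 2) ≤ 1 := by
      have hp : (1 / 2) ^ n * P j₁ ^ 2 ≤ ∑ j, (1 / 2) ^ n * P j ^ 2 :=
        Finset.single_le_sum (f := fun j => (1 / 2) ^ n * P j ^ 2)
          (fun _ _ => by positivity) (Finset.mem_univ j₁)
      have hp1 := (hP j₁).2.2 (h1 j₁ hj₁)
      have hp2 : (22 / 25) ^ 2 ≤ P j₁ ^ 2 := pow_le_pow_left₀ (by norm_num) hp1 2
      -- One solution suffices: 3^m ≥ 4√N bounds the left side by 9/(16N), below (22/25)²/N.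
      have hu2 : (3 / 3 ^ m : ℝ) ^ 2 ≤ ∑ j, (1 / 2) ^ n * P j ^ 2 := by
        refine le_trans ?_ hp
        rw [div_pow, div_le_iff₀ (by positivity)]
        have h2 : (0 : ℝ) < (1 / 2) ^ n := by positivity
        have h3 : (1 / 2) ^ n * (22 / 25) ^ 2 ≤ (1 / 2) ^ n * P j₁ ^ 2 := by gcongr
        have h4 := mul_le_mul h3 hm (by positivity) (by positivity)
        have h5 : ((1 : ℝ) / 2) ^ n * (22 / 25) ^ 2 * (16 * 2 ^ n) = (22 / 25) ^ 2 * 16 := by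
          linear_combination (22 / 25) ^ 2 * 16 * hN
        rw [h5] at h4
        norm_num at h4 ⊢
        linarith
      -- With cosh(u)² ≤ exp(u²) and 1 - p ≤ exp(-p), the starting condition follows from u² ≤ p.
      have h2 := Real.cosh_le_exp_half_sq (3 / 3 ^ m)
      have h3 : Real.cosh (3 / 3 ^ m) ^ 2 ≤ Real.exp ((3 / 3 ^ m) ^ 2) := by
        refine (pow_le_pow_left₀ (Real.cosh_pos _).le h2 2).trans_eq ?_
        rw [← Real.exp_nat_mul]
        congr 1
        push_cast
        ring
      have h4 := Real.one_sub_le_exp_neg (∑ j, (1 / 2) ^ n * P j ^ 2)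
      generalize ∑ j, (1 / 2) ^ n * P j ^ 2 = p at *
      have h5 : Real.cosh (3 / 3 ^ m) ^ 2 * (1 - p) ≤
          Real.cosh (3 / 3 ^ m) ^ 2 * Real.exp (-p) := by gcongr
      refine h5.trans ((mul_le_mul_of_nonneg_right h3 (Real.exp_pos _).le).trans ?_)
      rw [← Real.exp_add, Real.exp_le_one_iff]
      linarith
    have h2 := hcheb hu
    simp only [hg] at h2
    have h3 : (4 : ℝ) ^ 2 ≤ Real.cosh 3 ^ 2 :=
      pow_le_pow_left₀ (by norm_num) four_le_cosh_three 2
    have h4 : 1 - ∑ j, z * ((1 / 2) ^ n * P j ^ 2) ≤ 1 / 16 := by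
      by_contra h
      push Not at h
      nlinarith
    have h5 := Finset.sum_filter_add_sum_filter_not Finset.univ (fun j => F j = 0)
      (fun j => z * ((1 / 2) ^ n * P j ^ 2))
    have h6 : (Finset.univ.filter fun j => ¬ F j = 0) =
        Finset.univ.filter fun j => F j = 1 ∨ F j = 2 := by
      ext j
      simp only [Finset.mem_filter, Finset.mem_univ, true_and]
      generalize F j = f
      revert f
      decide
    rw [h6] at h5
    simp only [hamp, hg]
    linarith
  · simp only [hsum]
    linarith

theorem weight_searchProg (a b n x r m : ℕ) :
    OracleCircuit.weight a b (searchProg n x r m) ≤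
      3 ^ m * (4 * 3 ^ (2 * r + 4)) * (a * (17 * n + 8 * x + 28) + b) := by
  have hcard : Fintype.card (Reg n x) = 2 * n + x + 3 := by
    simp only [Fintype.card_sum, Fintype.card_fin, Fintype.card_unit]
    ring
  have h1 := weight_foldl a b (offList ∅ outW) outW outW (flagProg (gapProg n x r))
    (chebList (3 / 3 ^ m) m)
  have h2 := weight_flagProg a b (gapProg n x r)
  have h3 := weight_foldl a b (offList (offWork n x) oracleW) oracleW oracleW (baseProg n x)
    (gapList (r + 1))
  rw [chebList_length] at h1
  rw [gapList_length, weight_baseProg] at h3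
  have l1 := length_offList_le (∅ : Set (Reg n x)) outW
  have l2 := length_offList_le (offWork n x) oracleW
  rw [hcard] at h2 l1 l2
  change OracleCircuit.weight a b (searchProg n x r m) ≤ _ at h1
  change OracleCircuit.weight a b (gapProg n x r) ≤ _ at h3
  rw [show 2 * (r + 1) + 2 = 2 * r + 4 by ring] at h3
  refine h1.trans ?_
  rw [mul_assoc]
  refine Nat.mul_le_mul_left _ ?_
  have hE : 1 ≤ 3 ^ (2 * r + 4) := Nat.one_le_pow _ _ (by norm_num)
  generalize 3 ^ (2 * r + 4) = E at *
  -- `G` dominates the base cost with its overhead and each later overhead; 17n + 8x + 28 is n +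
  -- 8(2n + x + 3) + 4. The factor 4 counts the gap circuit and its inverse, plus two overheads.
  set G := a * (17 * n + 8 * x + 28) + b with hG
  have e1 : n * a + b + a * (8 * (offList (offWork n x) oracleW).length + 4) ≤ G := by
    have := Nat.mul_le_mul_left (8 * a) l2
    nlinarith
  have e2 : a * (8 * (offList (∅ : Set (Reg n x)) outW).length + 4) ≤ G := by
    have := Nat.mul_le_mul_left (8 * a) l1
    nlinarith
  have e3 : a * (n + 8 * (2 * n + x + 3) + 4) ≤ G := by
    nlinarith
  have e4 := Nat.mul_le_mul_left E e1
  have e5 : G ≤ E * G := Nat.le_mul_of_pos_left _ hE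
  calc _ ≤ 2 * (E * G) + E * G + E * G := by omega
    _ = 4 * E * G := by ring

theorem exists_pow_three {y : ℝ} (hy : 1 ≤ y) : ∃ m : ℕ, y ≤ 3 ^ m ∧ (3 : ℝ) ^ m ≤ 3 * y := by
  obtain ⟨m, h1, h2⟩ := exists_nat_pow_near hy (by norm_num : (1 : ℝ) < 3)
  exact ⟨m + 1, h2.le, by rw [pow_succ]; linarith⟩

end Final

end QCirc

end

theorem mainTheorem3 :
    ∃ (C : ℝ) (k : ℕ), ∀ n x : ℕ, 1 ≤ n →
      ∃ (y : ℕ) (B : QCirc.OracleCircuit (QCirc.Wire n x) (QCirc.Wire n y)),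
        -- number of oracle calls, with `N = 2 ^ n` and `log₂ N = n`
        (B.queries : ℝ) ≤ C * Real.sqrt ((2 : ℝ) ^ n) * (n : ℝ) ^ k ∧
        -- size, relative to a circuit `D` that uses each of its `x` ancillary qubits
        (∀ D : QCirc.Circuit (QCirc.Wire n x),
          (∀ i : Fin x, D.Uses (Sum.inr (Sum.inr i))) →
          ((B.run D).size : ℝ) ≤
            C * Real.sqrt ((2 : ℝ) ^ n) * (n : ℝ) ^ k * ((max 1 D.size : ℕ) : ℝ)) ∧
        -- correctness
        ∀ (F : Fin (2 ^ n) → Fin 3) (D : QCirc.Circuit (QCirc.Wire n x)),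
          (∀ j, F j = 0 →
            2 / 3 ≤ ‖QCirc.amp D j false QCirc.zeros j false QCirc.zeros‖ ^ 2) →
          (∀ j, F j = 1 →
            2 / 3 ≤ ‖QCirc.amp D j true QCirc.zeros j false QCirc.zeros‖ ^ 2) →
          ((∃ j, F j = 1) →
            2 / 3 ≤ ∑ j : Fin (2 ^ n) with F j = 1 ∨ F j = 2,
              ‖QCirc.amp (B.run D) j true QCirc.zeros 0 false QCirc.zeros‖ ^ 2) ∧
          ∑ j : Fin (2 ^ n) with F j = 0, ∑ z : Fin y → Bool,
            ‖QCirc.amp (B.run D) j true z 0 false QCirc.zeros‖ ^ 2 ≤ 1 / 3 := by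
  -- 12 comes from 3^m ≤ 12√N, 4 · 6561 · n² from the flag and gap circuits, and 62 = 17 + 17 + 28
  -- from 17n + 8x + 28 + size(D) with x ≤ 2 size(D). This last sum contributes the third power of
  -- n.
  refine ⟨12 * (4 * 6561) * 62, 3, fun n x hn => ?_⟩
  have hn' : (1 : ℝ) ≤ n := by exact_mod_cast hn
  obtain ⟨r, hr, hr'⟩ := QCirc.exists_pow_three (y := (n : ℝ) + 2) (by linarith)
  have hs1 : 1 ≤ √((2 : ℝ) ^ n) := Real.one_le_sqrt.2 (one_le_pow₀ (by norm_num))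
  have hs2 : √((2 : ℝ) ^ n) ^ 2 = 2 ^ n := Real.sq_sqrt (by positivity)
  obtain ⟨m, hm, hm'⟩ := QCirc.exists_pow_three (y := 4 * √((2 : ℝ) ^ n)) (by linarith)
  -- n ≥ 1 gives 3^r ≤ 3(n + 2) ≤ 9n, and 81 · (9n)² = 6561 n².
  have hE : (3 : ℝ) ^ (2 * r + 4) ≤ 6561 * n ^ 2 := by
    have h1 : (3 : ℝ) ^ r ≤ 9 * n := by linarith
    have h2 := pow_le_pow_left₀ (by positivity) h1 2
    rw [pow_add, mul_comm 2 r, pow_mul]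
    nlinarith
  have hW : ∀ a b : ℕ, ∀ G : ℝ, (a * (17 * n + 8 * x + 28) + b : ℝ) ≤ G →
      (QCirc.OracleCircuit.weight a b (QCirc.OracleCircuit.relabel
        (QCirc.layout n x).toEmbedding (QCirc.searchProg n x r m)) : ℝ) ≤
          12 * (4 * 6561) * √((2 : ℝ) ^ n) * (n : ℝ) ^ 2 * G := by
    intro a b G hG
    rw [QCirc.OracleCircuit.weight_relabel]
    have h1 : (QCirc.OracleCircuit.weight a b (QCirc.searchProg n x r m) : ℝ) ≤
        3 ^ m * (4 * 3 ^ (2 * r + 4)) * (a * (17 * n + 8 * x + 28) + b) := by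
      exact_mod_cast QCirc.weight_searchProg a b n x r m
    calc _ ≤ _ := h1
      _ ≤ (3 * (4 * √((2 : ℝ) ^ n))) * (4 * (6561 * n ^ 2)) * G := by gcongr
      _ = _ := by ring
  refine ⟨QCirc.ancCount n x, QCirc.OracleCircuit.relabel (QCirc.layout n x).toEmbedding
    (QCirc.searchProg n x r m), ?_, fun D hD => ?_, fun F D h0 h1 => ?_⟩
  · rw [QCirc.OracleCircuit.queries_eq_weight]
    refine (hW 0 1 n (by push_cast; linarith)).trans ?_
    have : 0 ≤ √((2 : ℝ) ^ n) * (n : ℝ) ^ 3 := by positivity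
    nlinarith
  · rw [QCirc.OracleCircuit.size_run]
    have hx : x ≤ 2 * D.size := by
      obtain ⟨hfin, hcard⟩ := QCirc.card_uses_le D
      refine le_trans ?_ hcard
      have hsub : Set.range (fun i : Fin x => (Sum.inr (Sum.inr i) : QCirc.Wire n x)) ⊆
          {w | D.Uses w} := by
        rintro _ ⟨i, rfl⟩
        exact hD i
      have := Set.ncard_le_ncard hsub hfin
      rwa [← Set.image_univ, Set.ncard_image_of_injective _
        fun i k h => Sum.inr_injective (Sum.inr_injective h), Set.ncard_univ, Nat.card_eq_fintype_card,
        Fintype.card_fin] at this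
    have hd1 : (1 : ℝ) ≤ ((max 1 D.size : ℕ) : ℝ) := by exact_mod_cast le_max_left _ _
    have hd2 : (D.size : ℝ) ≤ ((max 1 D.size : ℕ) : ℝ) := by exact_mod_cast le_max_right _ _
    have hx' : (x : ℝ) ≤ 2 * D.size := by exact_mod_cast hx
    refine (hW 1 D.size (62 * (n * ((max 1 D.size : ℕ) : ℝ))) ?_).trans (le_of_eq (by ring))
    generalize ((max 1 D.size : ℕ) : ℝ) = d at *
    push_cast
    nlinarith [mul_nonneg (sub_nonneg.2 hn') (sub_nonneg.2 hd1)]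
  · refine QCirc.search_correct (by exact_mod_cast hr) ?_ ?_ F D h0 h1
    · have := pow_le_pow_left₀ (by positivity) hm 2
      rw [mul_pow, hs2] at this
      linarith
    · have := pow_le_pow_left₀ (by positivity) hm' 2
      rw [mul_pow, mul_pow, hs2] at this
      linarith
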